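/- A $C^*$-dynamical system $(\mathfrak A,T)$ is a unital $C^*$-algebra $\mathfrak A$ with a unital completely positive map $T:\mathfrak A\to\mathfrak A$. Let $E:\mathfrak A\to\mathfrak A$ be a norm-one projection, i.e. a bounded linear map with $E^2=E$ and $\|E\|=1$. The system $(\mathfrak A,T)$ is called unique $E$-ergodic if $\lim_{n}\frac1n\sum_{k=1}^{n}\varphi(T^k(x))=\varphi(E(x))$, and unique $E$-weakly mixing if $\lim_{n}\frac1n\sum_{k=0}^{n-1}|\varphi(T^k(x))-\varphi(E(x))|=0$, for all $x\in\mathfrak A$ and all states $\varphi$ of $\mathfrak A$. In either case $E$ is determined by $T$ and is a projection onto the fixed-point space $\{x: Tx=x\}$; it is denoted by $E_T$. Let $(\mathfrak A,T)$ and $(\mathfrak B,H)$ be $C^*$-dynamical systems that are unique $E_T$- and $E_H$-weakly mixing, respectively. Let $\mathfrak A\otimes\mathfrak B$ be the minimal (spatial) $C^*$-tensor product, i.e. for faithful unital $*$-representations $\pi$ of $\mathfrak A$ and $\rho$ of $\mathfrak B$ on Hilbert spaces $\mathcal H$ and $\mathcal K$, the norm-closed $*$-algebra generated by the operators $\pi(a)\otimes\rho(b)$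 on the Hilbert space tensor product of $\mathcal H$ and $\mathcal K$. Then there are a unital completely positive map $T\otimes H$ and a bounded linear map $E_T\otimes E_H$ on $\mathfrak A\otimes\mathfrak B$ with $(T\otimes H)(a\otimes b)=Ta\otimes Hb$ and $(E_T\otimes E_H)(a\otimes b)=E_Ta\otimes E_Hb$ for all $a\in\mathfrak A$, $b\in\mathfrak B$ (both are unique, since elementary tensors span a dense subspace), and $$E_{T\otimes H}=E_T\otimes E_H$$ in the following sense. 1. $E_T\otimes E_H$ is a norm-one projection whose range is the fixed-point space $\{z: (T\otimes H)z=z\}$. 2. If $(\mathfrak A\otimes\mathfrak B,T\otimes H)$ is unique $E$-ergodic or unique $E$-weakly mixing for some norm-one projection $E$, then $E=E_T\otimes E_H$. 3. If $(\mathfrak A\otimes\mathfrak B)^*=\mathfrak A^*\otimes\mathfrak B^*$, i.e. if the functionals $f\otimes g$ with $f\in\mathfrak A^*$, $g\in\mathfrak B^*$ span a norm-dense subspace of $(\mathfrak A\otimes\mathfrak B)^*$, then $(\mathfrak A\otimes\mathfrak B,T\otimes H)$ is unique $E_T\otimes E_H$-weakly mixing, so that $E_{T\otimes H}$ exists and equals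 $E_T\otimes E_H$. -/

import Mathlib

open scoped CStarAlgebra

/-- A state of a unital C⋆-algebra: a positive functional (positive on all `x⋆ x`) that sends
`1` to `1`. -/
structure IsState {A : Type*} [CStarAlgebra A] (φ : A →L[ℂ] ℂ) : Prop where
  nonneg : ∀ x : A, 0 ≤ (φ (star x * x)).re ∧ (φ (star x * x)).im = 0
  map_one : φ 1 = 1

/-- A projection of norm one (onto its range). -/
structure IsNormOneProjection {A : Type*} [CStarAlgebra A] (E : A →L[ℂ] A) : Prop where
  norm_eq_one : ‖E‖ = 1
  idem : ∀ x : A, E (E x) = E x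

/-- `(A, T)` is unique `E`-ergodic, where `E` is a norm-one projection. -/
structure IsUniqueErgodic {A : Type*} [CStarAlgebra A] (T : A → A) (E : A →L[ℂ] A) : Prop where
  proj : IsNormOneProjection E
  tendsto : ∀ φ : A →L[ℂ] ℂ, IsState φ → ∀ x : A,
    Filter.Tendsto (fun n : ℕ => (n : ℂ)⁻¹ * ∑ k ∈ Finset.Icc 1 n, φ (T^[k] x))
      Filter.atTop (nhds (φ (E x)))

/-- `(A, T)` is unique `E`-weakly mixing, where `E` is a norm-one projection. -/
structure IsUniqueWeakMixing {A : Type*} [CStarAlgebra A] (T : A → A) (E : A →L[ℂ] A) :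
    Prop where
  proj : IsNormOneProjection E
  tendsto : ∀ φ : A →L[ℂ] ℂ, IsState φ → ∀ x : A,
    Filter.Tendsto (fun n : ℕ => (n : ℝ)⁻¹ * ∑ k ∈ Finset.range n, ‖φ (T^[k] x) - φ (E x)‖)
      Filter.atTop (nhds 0)

/-- The Hilbert space tensor product of two Hilbert spaces. -/
def HilbertTensor (H K : Type*) [NormedAddCommGroup H] [InnerProductSpace ℂ H]
    [NormedAddCommGroup K] [InnerProductSpace ℂ K] : Type _ :=
  UniformSpace.Completion (TensorProduct ℂ H K)

section HilbertTensor

variable {H K : Type*} [NormedAddCommGroup H] [InnerProductSpace ℂ H]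
  [NormedAddCommGroup K] [InnerProductSpace ℂ K]

noncomputable instance : NormedAddCommGroup (HilbertTensor H K) :=
  inferInstanceAs (NormedAddCommGroup (UniformSpace.Completion (TensorProduct ℂ H K)))

noncomputable instance : InnerProductSpace ℂ (HilbertTensor H K) :=
  inferInstanceAs (InnerProductSpace ℂ (UniformSpace.Completion (TensorProduct ℂ H K)))

instance : CompleteSpace (HilbertTensor H K) :=
  inferInstanceAs (CompleteSpace (UniformSpace.Completion (TensorProduct ℂ H K)))

end HilbertTensor

section MinTensor

variable {A B H K : Type*} [CStarAlgebra A] [CStarAlgebra B]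
  [NormedAddCommGroup H] [InnerProductSpace ℂ H] [CompleteSpace H]
  [NormedAddCommGroup K] [InnerProductSpace ℂ K] [CompleteSpace K]

/-- The bounded operator `π a ⊗ ρ b` on the Hilbert space tensor product. -/
noncomputable def spatialOp (π : A →⋆ₐ[ℂ] (H →L[ℂ] H)) (ρ : B →⋆ₐ[ℂ] (K →L[ℂ] K))
    (a : A) (b : B) : HilbertTensor H K →L[ℂ] HilbertTensor H K :=
  (TensorProduct.mapL (π a) (ρ b)).completion

/-- The norm-closed star-algebra of operators generated by all `π a ⊗ ρ b`. -/
noncomputable def spatialSubalgebra (π : A →⋆ₐ[ℂ] (H →L[ℂ] H)) (ρ : B →⋆ₐ[ℂ] (K →L[ℂ] K)) :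
    StarSubalgebra ℂ (HilbertTensor H K →L[ℂ] HilbertTensor H K) :=
  (StarAlgebra.adjoin ℂ {S | ∃ a b, S = spatialOp π ρ a b}).topologicalClosure

/-- The minimal (spatial) C⋆-tensor product of `A` and `B`, realised through representations
`π` and `ρ`. For faithful `π` and `ρ` this is the completion of the algebraic tensor product in the
minimal C⋆-norm. -/
def MinTensor (π : A →⋆ₐ[ℂ] (H →L[ℂ] H)) (ρ : B →⋆ₐ[ℂ] (K →L[ℂ] K)) : Type _ :=
  spatialSubalgebra π ρ

noncomputable instance (π : A →⋆ₐ[ℂ] (H →L[ℂ] H)) (ρ : B →⋆ₐ[ℂ] (K →L[ℂ] K)) :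
    CStarAlgebra (MinTensor π ρ) :=
  haveI : IsClosed (spatialSubalgebra π ρ :
      Set (HilbertTensor H K →L[ℂ] HilbertTensor H K)) :=
    StarSubalgebra.isClosed_topologicalClosure _
  inferInstanceAs (CStarAlgebra (spatialSubalgebra π ρ))

/-- The order of the C⋆-algebra `MinTensor π ρ`. -/
noncomputable instance (π : A →⋆ₐ[ℂ] (H →L[ℂ] H)) (ρ : B →⋆ₐ[ℂ] (K →L[ℂ] K)) :
    PartialOrder (MinTensor π ρ) :=
  CStarAlgebra.spectralOrder _

instance (π : A →⋆ₐ[ℂ] (H →L[ℂ] H)) (ρ : B →⋆ₐ[ℂ] (K →L[ℂ] K)) :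
    StarOrderedRing (MinTensor π ρ) :=
  CStarAlgebra.spectralOrderedRing _

/-- The elementary tensor `a ⊗ b` in the minimal tensor product. -/
noncomputable def MinTensor.tmul (π : A →⋆ₐ[ℂ] (H →L[ℂ] H)) (ρ : B →⋆ₐ[ℂ] (K →L[ℂ] K))
    (a : A) (b : B) : MinTensor π ρ :=
  ⟨spatialOp π ρ a b, StarSubalgebra.le_topologicalClosure _
    (StarAlgebra.subset_adjoin ℂ _ ⟨a, b, rfl⟩)⟩

/-- `S` is the tensor product `S₁ ⊗ S₂` of maps. A continuous linear `S` is determined by this,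
since the elementary tensors span a dense subspace. -/
def IsTensorMap (π : A →⋆ₐ[ℂ] (H →L[ℂ] H)) (ρ : B →⋆ₐ[ℂ] (K →L[ℂ] K))
    (S₁ : A → A) (S₂ : B → B) (S : MinTensor π ρ → MinTensor π ρ) : Prop :=
  ∀ (a : A) (b : B),
    S (MinTensor.tmul π ρ a b) = MinTensor.tmul π ρ (S₁ a) (S₂ b)

/-- The condition `(A ⊗ B)^* = A^* ⊗ B^*`: the functionals `f ⊗ g` span a subspace
of the dual of `A ⊗ B` that is dense in the dual norm (this norm restricts to the conjugate cross
norm on the algebraic tensor product of the duals). -/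
def DualTensorCondition (π : A →⋆ₐ[ℂ] (H →L[ℂ] H)) (ρ : B →⋆ₐ[ℂ] (K →L[ℂ] K)) : Prop :=
  (Submodule.span ℂ {θ : MinTensor π ρ →L[ℂ] ℂ | ∃ (f : A →L[ℂ] ℂ) (g : B →L[ℂ] ℂ),
    ∀ (a : A) (b : B), θ (MinTensor.tmul π ρ a b) = f a * g b}).topologicalClosure = ⊤

end MinTensor

/-! Weak mixing, unlike ergodicity, is stable under products. If `u k → l` and `v k → m` in the
sense that the averages of the distances tend to zero, and `v` is bounded, then `u k * v k → l * m`
in the same sense (`StrongCesaro.mul`). States span the whole dual (`span_isState_eq_top`), so weak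
mixing holds along every functional, and `f (T^k a) * g (R^k b)` converges to `f (E_T a) * g (E_R
b)` for all `f`, `g`. Linearity, contractivity and density extend this to all of `A ⊗ B` and to the
norm closure of the span of the `f ⊗ g`, which is everything under the dual condition.

Without that condition, the matrix coefficients between vectors of the algebraic `H ⊗ K` are still
available (`strongCesaro_inner_ofAlg`), and they separate operators. Thus `E_T ⊗ E_R` is a weak
limit in mean of the contractions `T^k ⊗ R^k`. This makes it a contraction without complete
positivity of the two projections, identifies its range with the fixed points, and forces every
other candidate to agree with it.

The map `T ⊗ R` comes from testing positivity of operator matrices on elementary tensors. Slicing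
with vector functionals uses complete positivity of `T` in the first factor and then of `R` in the
second (`sum_inner_tmul_map_nonneg`). A 2×2 block matrix turns positivity into contractivity, so the
map extends to the completion. It stays completely positive there because a positive matrix is `N⋆N`
and the entries of `N` can be approximated. -/

section

open scoped ComplexOrder InnerProductSpace TensorProduct

/-! ### Positive matrices over a C⋆-algebra as positive quadratic forms -/

section MatrixRepresentation

variable {A H : Type*} [CStarAlgebra A]
  [NormedAddCommGroup H] [InnerProductSpace ℂ H] [CompleteSpace H]

/-- The action of a matrix over `A` on column vectors, through a representation of `A`. -/
noncomputable def matrixOp (π : A →⋆ₐ[ℂ] (H →L[ℂ] H)) {n : ℕ}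
    (M : CStarMatrix (Fin n) (Fin n) A) :
    PiLp 2 (fun _ : Fin n => H) →L[ℂ] PiLp 2 (fun _ : Fin n => H) :=
  ((PiLp.continuousLinearEquiv 2 ℂ (fun _ : Fin n => H)).symm : _ →L[ℂ] _) ∘L
    ContinuousLinearMap.pi (fun i => ∑ j, (π (M i j)) ∘L PiLp.proj 2 (fun _ : Fin n => H) j)

theorem matrixOp_apply (π : A →⋆ₐ[ℂ] (H →L[ℂ] H)) {n : ℕ}
    (M : CStarMatrix (Fin n) (Fin n) A) (v : PiLp 2 (fun _ : Fin n => H)) (i : Fin n) :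
    matrixOp π M v i = ∑ j, π (M i j) (v j) := by
  simp [matrixOp]

/-- The representation of the matrix algebra over `A` induced by a representation of `A`. -/
noncomputable def matrixRep (π : A →⋆ₐ[ℂ] (H →L[ℂ] H)) (n : ℕ) :
    CStarMatrix (Fin n) (Fin n) A →⋆ₐ[ℂ]
      (PiLp 2 (fun _ : Fin n => H) →L[ℂ] PiLp 2 (fun _ : Fin n => H)) where
  toFun := matrixOp π
  map_one' := by
    ext v i
    rw [matrixOp_apply, Finset.sum_eq_single i]
    · simp
    · intro j _ hj
      simp [CStarMatrix.one_apply_ne hj.symm]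
    · simp
  map_mul' M N := by
    ext v i
    simp only [matrixOp_apply, mul_apply_eq_comp, CStarMatrix.mul_apply, map_sum,
      map_mul, sum_apply]
    exact Finset.sum_comm
  map_zero' := by ext v i; simp [matrixOp_apply]
  map_add' M N := by
    ext v i
    simp [matrixOp_apply, Finset.sum_add_distrib]
  commutes' r := by
    ext v i
    rw [matrixOp_apply, Finset.sum_eq_single i]
    · simp [CStarMatrix.algebraMap_apply, Algebra.algebraMap_eq_smul_one]
    · intro j _ hj
      simp [CStarMatrix.algebraMap_apply, hj.symm]
    · simp
  map_star' M := by
    rw [ContinuousLinearMap.star_eq_adjoint, ContinuousLinearMap.eq_adjoint_iff]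
    intro v w
    simp only [PiLp.inner_apply, matrixOp_apply, sum_inner, inner_sum, CStarMatrix.star_apply,
      map_star, ContinuousLinearMap.star_eq_adjoint, ContinuousLinearMap.adjoint_inner_left]
    exact Finset.sum_comm

theorem matrixRep_apply (π : A →⋆ₐ[ℂ] (H →L[ℂ] H)) {n : ℕ}
    (M : CStarMatrix (Fin n) (Fin n) A) (v : PiLp 2 (fun _ : Fin n => H)) (i : Fin n) :
    matrixRep π n M v i = ∑ j, π (M i j) (v j) :=
  matrixOp_apply π M v i

theorem matrixRep_injective {π : A →⋆ₐ[ℂ] (H →L[ℂ] H)} (hπ : Function.Injective π) (n : ℕ) :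
    Function.Injective (matrixRep π n) := by
  intro M N h
  ext i j
  apply hπ
  ext x
  have := congrArg (fun S => S (WithLp.toLp 2 (Pi.single j x)) i) h
  simp only [matrixRep_apply] at this
  rw [Finset.sum_eq_single j, Finset.sum_eq_single j] at this
  · simpa using this
  all_goals simp +contextual

theorem IsSelfAdjoint.of_map_injective {A B : Type*} [CStarAlgebra A] [CStarAlgebra B]
    {φ : A →⋆ₐ[ℂ] B} (hφ : Function.Injective φ) {a : A} (h : IsSelfAdjoint (φ a)) :
    IsSelfAdjoint a :=
  hφ (by rw [map_star]; exact h)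

/-- An injective ⋆-homomorphism preserves the spectrum of self-adjoint elements. -/
theorem StarAlgHom.nonneg_iff_of_injective {A B : Type*} [CStarAlgebra A] [CStarAlgebra B]
    [PartialOrder A] [StarOrderedRing A] [PartialOrder B] [StarOrderedRing B]
    {φ : A →⋆ₐ[ℂ] B} (hφ : Function.Injective φ) {a : A} : 0 ≤ a ↔ 0 ≤ φ a := by
  refine ⟨fun h => map_nonneg φ h, fun h => ?_⟩
  have ha : IsSelfAdjoint a := .of_map_injective hφ (.of_nonneg h)
  rw [StarOrderedRing.nonneg_iff_spectrum_nonneg (R := ℝ) a ha]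
  rw [StarOrderedRing.nonneg_iff_spectrum_nonneg (R := ℝ) _ (.of_nonneg h),
    IsSelfAdjoint.map_spectrum_real ha φ hφ] at h
  exact h

theorem cstarMatrix_nonneg_iff [PartialOrder A] [StarOrderedRing A]
    {π : A →⋆ₐ[ℂ] (H →L[ℂ] H)} (hπ : Function.Injective π) {n : ℕ}
    (M : CStarMatrix (Fin n) (Fin n) A) :
    0 ≤ M ↔ ∀ v : Fin n → H, 0 ≤ ∑ i, ∑ j, ⟪v i, π (M i j) (v j)⟫_ℂ := by
  rw [StarAlgHom.nonneg_iff_of_injective (matrixRep_injective hπ n),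
    ContinuousLinearMap.nonneg_iff_isPositive]
  have key (v : Fin n → H) : ∑ i, ∑ j, ⟪v i, π (M i j) (v j)⟫_ℂ
      = ⟪WithLp.toLp 2 v, matrixRep π n M (WithLp.toLp 2 v)⟫_ℂ := by
    simp [PiLp.inner_apply, matrixRep_apply, inner_sum]
  constructor
  · intro h v
    rw [key]
    exact h.inner_nonneg_right _
  · intro h
    rw [ContinuousLinearMap.isPositive_iff_complex]
    intro v
    have := h v.ofLp
    rw [key, WithLp.toLp_ofLp] at this
    obtain ⟨hre, him⟩ := Complex.nonneg_iff.1 this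
    rw [← inner_conj_symm, Complex.conj_eq_iff_im.2 him.symm]
    exact ⟨Complex.ext rfl him, hre⟩

/-- Complete positivity in the form used throughout. Arbitrary finite index types are allowed
because decomposing vectors into elementary tensors produces sigma types. -/
theorem CompletelyPositiveMap.sum_inner_nonneg [PartialOrder A] [StarOrderedRing A]
    {π : A →⋆ₐ[ℂ] (H →L[ℂ] H)} (hπ : Function.Injective π) (T : A →CP A)
    {ι : Type*} [Fintype ι] (X : ι → ι → A)
    (hX : ∀ v : ι → H, 0 ≤ ∑ i, ∑ j, ⟪v i, π (X i j) (v j)⟫_ℂ) (v : ι → H) :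
    0 ≤ ∑ i, ∑ j, ⟪v i, π (T (X i j)) (v j)⟫_ℂ := by
  let e := Fintype.equivFin ι
  have transport (Y : ι → ι → A) (w : ι → H) :
      ∑ i, ∑ j, ⟪w i, π (Y i j) (w j)⟫_ℂ = ∑ i, ∑ j,
        ⟪w (e.symm i), π (Y (e.symm i) (e.symm j)) (w (e.symm j))⟫_ℂ := by
    rw [← e.symm.sum_comp]
    exact Finset.sum_congr rfl fun i _ => (e.symm.sum_comp _).symm
  let M : CStarMatrix (Fin (Fintype.card ι)) (Fin (Fintype.card ι)) A :=
    CStarMatrix.ofMatrix fun i j => X (e.symm i) (e.symm j)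
  have hM : 0 ≤ M := by
    rw [cstarMatrix_nonneg_iff hπ]
    intro w
    have := hX (fun i => w (e i))
    rw [transport] at this
    simp only [Equiv.apply_symm_apply] at this
    exact this
  have := (cstarMatrix_nonneg_iff hπ _).1 (T.map_cstarMatrix_nonneg' _ M hM) (fun i => v (e.symm i))
  rw [transport (fun i j => T (X i j))]
  exact this

end MatrixRepresentation

/-! ### The algebraic tensor product inside the spatial one -/

section SpatialTensor

variable {A B H K : Type*} [CStarAlgebra A] [CStarAlgebra B]
  [NormedAddCommGroup H] [InnerProductSpace ℂ H] [CompleteSpace H]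
  [NormedAddCommGroup K] [InnerProductSpace ℂ K] [CompleteSpace K]

/-- The inclusion of the algebraic tensor product in the Hilbert space tensor product. -/
noncomputable def HilbertTensor.incl (H K : Type*) [NormedAddCommGroup H] [InnerProductSpace ℂ H]
    [NormedAddCommGroup K] [InnerProductSpace ℂ K] : H ⊗[ℂ] K →ₗᵢ[ℂ] HilbertTensor H K :=
  (UniformSpace.Completion.toComplₗᵢ :
    H ⊗[ℂ] K →ₗᵢ[ℂ] UniformSpace.Completion (H ⊗[ℂ] K))

omit [CompleteSpace H] [CompleteSpace K] in
theorem HilbertTensor.denseRange_incl : DenseRange (HilbertTensor.incl H K) :=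
  UniformSpace.Completion.denseRange_coe (α := H ⊗[ℂ] K)

omit [CompleteSpace H] [CompleteSpace K] in
theorem HilbertTensor.clm_ext {E : Type*} [NormedAddCommGroup E] [NormedSpace ℂ E]
    {S S' : HilbertTensor H K →L[ℂ] E}
    (h : ∀ x y, S (incl H K (x ⊗ₜ y)) = S' (incl H K (x ⊗ₜ y))) : S = S' := by
  have hlin : S.toLinearMap ∘ₗ (incl H K).toLinearMap = S'.toLinearMap ∘ₗ (incl H K).toLinearMap :=
    TensorProduct.ext' h
  ext v
  exact congrFun (HilbertTensor.denseRange_incl.equalizer S.continuous S'.continuous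
    (funext fun w => LinearMap.congr_fun hlin w)) v

variable (π : A →⋆ₐ[ℂ] (H →L[ℂ] H)) (ρ : B →⋆ₐ[ℂ] (K →L[ℂ] K))

theorem spatialOp_incl (a : A) (b : B) (z : H ⊗[ℂ] K) :
    spatialOp π ρ a b (HilbertTensor.incl H K z) =
      HilbertTensor.incl H K (TensorProduct.mapL (π a) (ρ b) z) :=
  ContinuousLinearMap.completion_apply_coe (TensorProduct.mapL (π a) (ρ b)) z

theorem spatialOp_incl_tmul (a : A) (b : B) (x : H) (y : K) :
    spatialOp π ρ a b (HilbertTensor.incl H K (x ⊗ₜ y)) =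
      HilbertTensor.incl H K (π a x ⊗ₜ ρ b y) := by
  rw [spatialOp_incl, TensorProduct.mapL_tmul]

namespace MinTensor

/-- The defining representation of the minimal tensor product. -/
noncomputable def val :
    MinTensor π ρ →⋆ₐ[ℂ] (HilbertTensor H K →L[ℂ] HilbertTensor H K) :=
  (spatialSubalgebra π ρ).subtype

theorem val_injective : Function.Injective (val π ρ) := Subtype.val_injective

theorem norm_val (z : MinTensor π ρ) : ‖val π ρ z‖ = ‖z‖ := rfl

theorem val_tmul (a : A) (b : B) : val π ρ (tmul π ρ a b) = spatialOp π ρ a b := rfl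

theorem ext_val {z w : MinTensor π ρ}
    (h : ∀ x y, val π ρ z (HilbertTensor.incl H K (x ⊗ₜ y)) =
      val π ρ w (HilbertTensor.incl H K (x ⊗ₜ y))) : z = w :=
  val_injective π ρ (HilbertTensor.clm_ext h)

/-- The canonical map of the algebraic tensor product into the minimal tensor product. -/
noncomputable def ofAlg : A ⊗[ℂ] B →ₗ[ℂ] MinTensor π ρ :=
  TensorProduct.lift (LinearMap.mk₂ ℂ (tmul π ρ)
    (fun a a' b => ext_val π ρ fun x y => by
      simp [val_tmul, spatialOp_incl_tmul, TensorProduct.add_tmul])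
    (fun c a b => ext_val π ρ fun x y => by
      simp [val_tmul, spatialOp_incl_tmul, ← TensorProduct.smul_tmul'])
    (fun a b b' => ext_val π ρ fun x y => by
      simp [val_tmul, spatialOp_incl_tmul, TensorProduct.tmul_add])
    (fun c a b => ext_val π ρ fun x y => by
      simp [val_tmul, spatialOp_incl_tmul]))

@[simp] theorem ofAlg_tmul (a : A) (b : B) : ofAlg π ρ (a ⊗ₜ b) = tmul π ρ a b := rfl

theorem tmul_one_one : tmul π ρ 1 1 = 1 :=
  ext_val π ρ fun x y => by simp [val_tmul, spatialOp_incl_tmul]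

theorem tmul_mul_tmul (a a' : A) (b b' : B) :
    tmul π ρ a b * tmul π ρ a' b' = tmul π ρ (a * a') (b * b') :=
  ext_val π ρ fun x y => by simp [val_tmul, spatialOp_incl_tmul]

theorem inner_val_tmul (a : A) (b : B) (x x' : H) (y y' : K) :
    ⟪HilbertTensor.incl H K (x ⊗ₜ y),
      val π ρ (tmul π ρ a b) (HilbertTensor.incl H K (x' ⊗ₜ y'))⟫_ℂ =
      ⟪x, π a x'⟫_ℂ * ⟪y, ρ b y'⟫_ℂ := by
  rw [val_tmul, spatialOp_incl_tmul, LinearIsometry.inner_map_map, TensorProduct.inner_tmul]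

omit [CompleteSpace H] [CompleteSpace K] in
theorem ext_inner_incl {u v : HilbertTensor H K}
    (h : ∀ x y, ⟪HilbertTensor.incl H K (x ⊗ₜ y), u⟫_ℂ = ⟪HilbertTensor.incl H K (x ⊗ₜ y), v⟫_ℂ) :
    u = v := by
  apply ext_inner_right ℂ
  intro w
  have : innerSL ℂ u = innerSL ℂ v := HilbertTensor.clm_ext fun x y => by
    rw [innerSL_apply_apply, innerSL_apply_apply, ← inner_conj_symm, h, inner_conj_symm]
  exact DFunLike.congr_fun this w

theorem star_tmul (a : A) (b : B) : star (tmul π ρ a b) = tmul π ρ (star a) (star b) :=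
  ext_val π ρ fun x y => ext_inner_incl fun x' y' => by
    rw [inner_val_tmul, map_star, ContinuousLinearMap.star_eq_adjoint,
      ContinuousLinearMap.adjoint_inner_right, ← inner_conj_symm, inner_val_tmul]
    simp only [map_mul, inner_conj_symm, map_star, ContinuousLinearMap.star_eq_adjoint,
      ContinuousLinearMap.adjoint_inner_right]

theorem ofAlg_mul (z w : A ⊗[ℂ] B) : ofAlg π ρ (z * w) = ofAlg π ρ z * ofAlg π ρ w := by
  induction z with
  | zero => simp
  | add z z' hz hz' => simp [add_mul, hz, hz']
  | tmul a b =>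
    induction w with
    | zero => simp
    | add w w' hw hw' => simp [mul_add, hw, hw']
    | tmul a' b' => simp [Algebra.TensorProduct.tmul_mul_tmul, tmul_mul_tmul]

theorem ofAlg_star (z : A ⊗[ℂ] B) : ofAlg π ρ (star z) = star (ofAlg π ρ z) := by
  induction z with
  | zero => simp
  | add z z' hz hz' => simp [hz, hz']
  | tmul a b => simp [star_tmul]

theorem ofAlg_one : ofAlg π ρ 1 = 1 := tmul_one_one π ρ

/-- The image of the algebraic tensor product is already a unital ⋆-algebra containing the
generators, so it exhausts the ⋆-algebra whose closure is taken. -/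
theorem denseRange_ofAlg : DenseRange (ofAlg π ρ) := by
  have hadj : ∀ S ∈ StarAlgebra.adjoin ℂ {S | ∃ a b, S = spatialOp π ρ a b},
      ∃ z, val π ρ (ofAlg π ρ z) = S := by
    intro S hS
    induction hS using StarAlgebra.adjoin_induction with
    | mem S hS =>
      obtain ⟨a, b, rfl⟩ := hS
      exact ⟨a ⊗ₜ b, rfl⟩
    | algebraMap c => exact ⟨c • 1, by simp [ofAlg_one, Algebra.algebraMap_eq_smul_one]⟩
    | add S S' _ _ h h' =>
      obtain ⟨z, rfl⟩ := h
      obtain ⟨z', rfl⟩ := h'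
      exact ⟨z + z', by simp⟩
    | mul S S' _ _ h h' =>
      obtain ⟨z, rfl⟩ := h
      obtain ⟨z', rfl⟩ := h'
      exact ⟨z * z', by simp [ofAlg_mul]⟩
    | star S _ h =>
      obtain ⟨z, rfl⟩ := h
      exact ⟨star z, by rw [ofAlg_star, map_star]⟩
  intro w
  rw [Metric.mem_closure_iff]
  intro ε hε
  have hw : val π ρ w ∈ closure
      (StarAlgebra.adjoin ℂ {S | ∃ a b, S = spatialOp π ρ a b} : Set _) := Subtype.prop w
  obtain ⟨S, hS, hd⟩ := Metric.mem_closure_iff.1 hw ε hε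
  obtain ⟨z, rfl⟩ := hadj S hS
  exact ⟨_, ⟨z, rfl⟩, hd⟩

end MinTensor

end SpatialTensor

/-! ### Slice maps and positivity of tensor products of completely positive maps -/

section Slice

variable {A B : Type*} [CStarAlgebra A] [CStarAlgebra B]

/-- The slice map `a ⊗ b ↦ g b • a`. -/
noncomputable def sliceLeft (g : B →ₗ[ℂ] ℂ) : A ⊗[ℂ] B →ₗ[ℂ] A :=
  TensorProduct.lift ((LinearMap.lsmul ℂ A).flip.compr₂ LinearMap.id |>.compl₂ g)

/-- The slice map `a ⊗ b ↦ f a • b`. -/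
noncomputable def sliceRight (f : A →ₗ[ℂ] ℂ) : A ⊗[ℂ] B →ₗ[ℂ] B :=
  TensorProduct.lift (LinearMap.lsmul ℂ B ∘ₗ f)

@[simp] theorem sliceLeft_tmul (g : B →ₗ[ℂ] ℂ) (a : A) (b : B) :
    sliceLeft g (a ⊗ₜ b) = g b • a := rfl

@[simp] theorem sliceRight_tmul (f : A →ₗ[ℂ] ℂ) (a : A) (b : B) :
    sliceRight f (a ⊗ₜ b) = f a • b := rfl

end Slice
section VectorFunctional

variable {A B H K : Type*} [CStarAlgebra A] [CStarAlgebra B]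
  [NormedAddCommGroup H] [InnerProductSpace ℂ H] [CompleteSpace H]
  [NormedAddCommGroup K] [InnerProductSpace ℂ K] [CompleteSpace K]

/-- The functional `a ↦ ⟪x, π a y⟫`. -/
noncomputable def vectorFunctional (π : A →⋆ₐ[ℂ] (H →L[ℂ] H)) (x y : H) : A →L[ℂ] ℂ :=
  (innerSL ℂ x ∘L ContinuousLinearMap.apply ℂ H y) ∘L
    { (π : A →ₗ[ℂ] (H →L[ℂ] H)) with cont := map_continuous π }

@[simp] theorem vectorFunctional_apply (π : A →⋆ₐ[ℂ] (H →L[ℂ] H)) (x y : H) (a : A) :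
    vectorFunctional π x y a = ⟪x, π a y⟫_ℂ := rfl

variable (π : A →⋆ₐ[ℂ] (H →L[ℂ] H)) (ρ : B →⋆ₐ[ℂ] (K →L[ℂ] K))

theorem inner_ofAlg_map_sliceLeft (T : A →ₗ[ℂ] A) (R : B →ₗ[ℂ] B) (z : A ⊗[ℂ] B)
    (x x' : H) (y y' : K) :
    ⟪HilbertTensor.incl H K (x ⊗ₜ y), MinTensor.val π ρ (MinTensor.ofAlg π ρ
      (TensorProduct.map T R z)) (HilbertTensor.incl H K (x' ⊗ₜ y'))⟫_ℂ =
    ⟪x, π (T (sliceLeft ((vectorFunctional ρ y y').toLinearMap ∘ₗ R) z)) x'⟫_ℂ := by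
  induction z with
  | zero => simp
  | add z z' h h' => simp [h, h']
  | tmul a b => simp [MinTensor.inner_val_tmul, mul_comm]

theorem inner_sliceLeft_comp (R : B →ₗ[ℂ] B) (z : A ⊗[ℂ] B) (x x' : H) (y y' : K) :
    ⟪x, π (sliceLeft ((vectorFunctional ρ y y').toLinearMap ∘ₗ R) z) x'⟫_ℂ =
    ⟪y, ρ (R (sliceRight (vectorFunctional π x x').toLinearMap z)) y'⟫_ℂ := by
  induction z with
  | zero => simp
  | add z z' h h' => simp [h, h']
  | tmul a b => simp [mul_comm]

theorem inner_sliceRight (z : A ⊗[ℂ] B) (x x' : H) (y y' : K) :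
    ⟪y, ρ (sliceRight (vectorFunctional π x x').toLinearMap z) y'⟫_ℂ =
    ⟪HilbertTensor.incl H K (x ⊗ₜ y), MinTensor.val π ρ (MinTensor.ofAlg π ρ z)
      (HilbertTensor.incl H K (x' ⊗ₜ y'))⟫_ℂ := by
  induction z with
  | zero => simp
  | add z z' h h' => simp [h, h']
  | tmul a b => simp [MinTensor.inner_val_tmul]

variable {π ρ} [PartialOrder A] [StarOrderedRing A] [PartialOrder B] [StarOrderedRing B]

/-- With `y` fixed, the form is that of `T` applied to a matrix of slices in `A`, so `T` may be
removed. With `x` fixed, what remains is `R` applied to a matrix of slices in `B`, so `R` may be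
removed as well. -/
theorem sum_inner_tmul_map_nonneg (hπ : Function.Injective π) (hρ : Function.Injective ρ)
    (T : A →CP A) (R : B →CP B) {ι : Type*} [Fintype ι] (z : ι → ι → A ⊗[ℂ] B)
    (hz : ∀ (x : ι → H) (y : ι → K), 0 ≤ ∑ i, ∑ j, ⟪HilbertTensor.incl H K (x i ⊗ₜ y i),
      MinTensor.val π ρ (MinTensor.ofAlg π ρ (z i j)) (HilbertTensor.incl H K (x j ⊗ₜ y j))⟫_ℂ)
    (x : ι → H) (y : ι → K) :
    0 ≤ ∑ i, ∑ j, ⟪HilbertTensor.incl H K (x i ⊗ₜ y i),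
      MinTensor.val π ρ (MinTensor.ofAlg π ρ (TensorProduct.map (T : A →ₗ[ℂ] A) (R : B →ₗ[ℂ] B)
        (z i j))) (HilbertTensor.incl H K (x j ⊗ₜ y j))⟫_ℂ := by
  simp only [inner_ofAlg_map_sliceLeft]
  refine T.sum_inner_nonneg hπ (fun i j => sliceLeft
    ((vectorFunctional ρ (y i) (y j)).toLinearMap ∘ₗ (R : B →ₗ[ℂ] B)) (z i j)) (fun x => ?_) x
  simp only [inner_sliceLeft_comp]
  refine R.sum_inner_nonneg hρ
    (fun i j => sliceRight (vectorFunctional π (x i) (x j)).toLinearMap (z i j)) (fun y => ?_) y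
  simp only [inner_sliceRight]
  exact hz x y

/-- Each `u i` is a finite sum of elementary tensors. Repeating the index `i` once per summand, with
the entries `z i j` duplicated, reduces to elementary tensors; regrouping the sums shows that the
enlarged matrix is still positive. -/
theorem sum_inner_map_nonneg (hπ : Function.Injective π) (hρ : Function.Injective ρ)
    (T : A →CP A) (R : B →CP B) {ι : Type*} [Fintype ι] (z : ι → ι → A ⊗[ℂ] B)
    (hz : ∀ u : ι → H ⊗[ℂ] K, 0 ≤ ∑ i, ∑ j, ⟪HilbertTensor.incl H K (u i),
      MinTensor.val π ρ (MinTensor.ofAlg π ρ (z i j)) (HilbertTensor.incl H K (u j))⟫_ℂ)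
    (u : ι → H ⊗[ℂ] K) :
    0 ≤ ∑ i, ∑ j, ⟪HilbertTensor.incl H K (u i),
      MinTensor.val π ρ (MinTensor.ofAlg π ρ (TensorProduct.map (T : A →ₗ[ℂ] A) (R : B →ₗ[ℂ] B)
        (z i j))) (HilbertTensor.incl H K (u j))⟫_ℂ := by
  choose S hS using fun i => TensorProduct.exists_finset (u i)
  have expand (Z : ι → ι → A ⊗[ℂ] B) (x : (Σ i, S i) → H) (y : (Σ i, S i) → K) :
      ∑ i, ∑ j, ⟪HilbertTensor.incl H K (x i ⊗ₜ y i), MinTensor.val π ρ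
        (MinTensor.ofAlg π ρ (Z i.1 j.1)) (HilbertTensor.incl H K (x j ⊗ₜ y j))⟫_ℂ =
      ∑ i, ∑ j, ⟪HilbertTensor.incl H K (∑ s, x ⟨i, s⟩ ⊗ₜ y ⟨i, s⟩), MinTensor.val π ρ
        (MinTensor.ofAlg π ρ (Z i j)) (HilbertTensor.incl H K (∑ s, x ⟨j, s⟩ ⊗ₜ y ⟨j, s⟩))⟫_ℂ := by
    simp only [Fintype.sum_sigma, map_sum, sum_inner, inner_sum]
    refine Finset.sum_congr rfl fun i _ => ?_
    rw [Finset.sum_comm]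
    refine Finset.sum_congr rfl fun j _ => ?_
    exact Finset.sum_comm
  have := sum_inner_tmul_map_nonneg hπ hρ T R (ι := Σ i, S i) (fun i j => z i.1 j.1)
    (fun x y => by rw [expand]; exact hz _) (fun i => i.2.1.1) (fun i => i.2.1.2)
  rw [expand (fun i j => TensorProduct.map (T : A →ₗ[ℂ] A) (R : B →ₗ[ℂ] B) (z i j))] at this
  convert this using 8 <;>
  · rw [hS, ← Finset.sum_coe_sort]

end VectorFunctional

/-! ### Norm bounds from 2×2 blocks, and density arguments for positivity -/

theorem inner_self_eq_ofReal_norm_sq {L : Type*} [NormedAddCommGroup L]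
    [InnerProductSpace ℂ L] (w : L) : ⟪w, w⟫_ℂ = ((‖w‖ ^ 2 : ℝ) : ℂ) := by
  rw [inner_self_eq_norm_sq_to_K]
  simp

theorem ContinuousLinearMap.block_nonneg {L : Type*} [NormedAddCommGroup L]
    [InnerProductSpace ℂ L] {S : L →L[ℂ] L} {c : ℝ} (hS : ‖S‖ ≤ c) (u v : L) :
    0 ≤ (c : ℂ) * ⟪u, u⟫_ℂ + ⟪u, S v⟫_ℂ + (⟪S v, u⟫_ℂ + (c : ℂ) * ⟪v, v⟫_ℂ) := by
  have hb : ‖⟪u, S v⟫_ℂ‖ ≤ c * (‖u‖ * ‖v‖) := by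
    calc ‖⟪u, S v⟫_ℂ‖ ≤ ‖u‖ * ‖S v‖ := norm_inner_le_norm _ _
      _ ≤ ‖u‖ * (c * ‖v‖) := by gcongr; exact S.le_of_opNorm_le hS v
      _ = c * (‖u‖ * ‖v‖) := by ring
  have hre := (abs_le.1 ((Complex.abs_re_le_norm ⟪u, S v⟫_ℂ).trans hb)).1
  have hc : 0 ≤ c := (norm_nonneg S).trans hS
  rw [← inner_conj_symm (S v) u, inner_self_eq_ofReal_norm_sq, inner_self_eq_ofReal_norm_sq,
    Complex.nonneg_iff]
  simp only [← Complex.ofReal_mul, Complex.add_re, Complex.add_im, Complex.ofReal_re,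
    Complex.ofReal_im, Complex.conj_re, Complex.conj_im]
  constructor
  · nlinarith [mul_nonneg hc (sq_nonneg (‖u‖ - ‖v‖))]
  · ring

/-- Converse of `block_nonneg`. The corner `S'` is not assumed to be the adjoint of `S`; reality of
the form supplies what is needed. -/
theorem ContinuousLinearMap.opNorm_le_of_block_nonneg {L : Type*} [NormedAddCommGroup L]
    [InnerProductSpace ℂ L] {S S' : L →L[ℂ] L} {c : ℝ} (hc : 0 < c)
    (h : ∀ u v, 0 ≤ (c : ℂ) * ⟪u, u⟫_ℂ + ⟪u, S v⟫_ℂ + (⟪v, S' u⟫_ℂ + (c : ℂ) * ⟪v, v⟫_ℂ)) :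
    ‖S‖ ≤ c := by
  have hre (u v : L) : (⟪v, S' u⟫_ℂ).re = (⟪u, S v⟫_ℂ).re := by
    -- Multiplying `u` by `I` turns the vanishing imaginary part into an equality of real parts.
    have h1 := (Complex.nonneg_iff.1 (h (Complex.I • u) v)).2
    simp only [inner_self_eq_ofReal_norm_sq] at h1
    simp only [map_smul, inner_smul_left, inner_smul_right, ← Complex.ofReal_mul,
      Complex.add_im, Complex.ofReal_im, Complex.conj_I, Complex.mul_im, Complex.neg_im,
      Complex.neg_re, Complex.I_im, Complex.I_re] at h1
    linarith
  refine ContinuousLinearMap.opNorm_le_bound _ hc.le fun v => ?_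
  -- For fixed `v`, the form is smallest at `u = -c⁻¹ S v`.
  have h1 := (Complex.nonneg_iff.1 (h (-((c⁻¹ : ℝ) : ℂ) • S v) v)).1
  simp only [Complex.add_re, hre] at h1
  simp only [inner_self_eq_ofReal_norm_sq] at h1
  simp only [inner_self_eq_ofReal_norm_sq, inner_smul_left, ← Complex.ofReal_mul,
    ← Complex.ofReal_neg, Complex.conj_ofReal, Complex.ofReal_re, norm_smul, Complex.norm_real, Real.norm_eq_abs,
    abs_neg, abs_inv, abs_of_pos hc] at h1
  have h2 : ‖S v‖ ^ 2 ≤ (c * ‖v‖) ^ 2 := by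
    have h3 : c * (c⁻¹ * ‖S v‖) ^ 2 + -c⁻¹ * ‖S v‖ ^ 2 + (-c⁻¹ * ‖S v‖ ^ 2 + c * ‖v‖ ^ 2)
        = c⁻¹ * ((c * ‖v‖) ^ 2 - ‖S v‖ ^ 2) := by
      field_simp
      ring
    rw [h3] at h1
    have := nonneg_of_mul_nonneg_right h1 (inv_pos.2 hc)
    linarith
  exact le_of_sq_le_sq h2 (by positivity)

theorem sum_inner_sum_star_mul {L : Type*} [NormedAddCommGroup L] [InnerProductSpace ℂ L]
    [CompleteSpace L] {ι : Type*} [Fintype ι] (X : ι → ι → L →L[ℂ] L) (v : ι → L) :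
    ∑ i, ∑ j, ⟪v i, (∑ k, star (X k i) * X k j) (v j)⟫_ℂ =
      ∑ k, ⟪∑ i, X k i (v i), ∑ i, X k i (v i)⟫_ℂ := by
  simp only [sum_apply, inner_sum, sum_inner, mul_apply_eq_comp,
    ContinuousLinearMap.star_eq_adjoint, ContinuousLinearMap.adjoint_inner_right]
  rw [Finset.sum_congr rfl fun i _ => Finset.sum_comm, Finset.sum_comm]
  exact Finset.sum_congr rfl fun k _ => Finset.sum_comm

/-- Nonnegativity is a closed condition on the finitely many entries and vectors jointly, so these
can be approximated without any norm on the matrix algebra. -/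
theorem sum_inner_sum_star_mul_nonneg_of_dense {C L X V : Type*} [CStarAlgebra C]
    [NormedAddCommGroup L] [InnerProductSpace ℂ L] {F : C → L →L[ℂ] L} (hF : Continuous F)
    {e : X → C} (he : DenseRange e) {e' : V → L} (he' : DenseRange e') {ι : Type*} [Fintype ι]
    (h : ∀ (y : ι → ι → X) (u : ι → V), 0 ≤ ∑ i, ∑ j,
      ⟪e' (u i), F (∑ k, star (e (y k i)) * e (y k j)) (e' (u j))⟫_ℂ)
    (N : ι → ι → C) (v : ι → L) :
    0 ≤ ∑ i, ∑ j, ⟪v i, F (∑ k, star (N k i) * N k j) (v j)⟫_ℂ := by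
  have hdense : DenseRange (Pi.map fun _ : ι => Pi.map fun _ : ι => e) :=
    DenseRange.piMap fun _ => DenseRange.piMap fun _ => he
  have hdense' : DenseRange (Pi.map fun _ : ι => e') := DenseRange.piMap fun _ => he'
  refine isClosed_property (hdense.prodMap hdense') (p := fun p => 0 ≤ ∑ i, ∑ j,
    ⟪p.2 i, F (∑ k, star (p.1 k i) * p.1 k j) (p.2 j)⟫_ℂ) ?_ (fun p => h p.1 p.2) (N, v)
  exact isClosed_le continuous_const (by fun_prop)

theorem CStarAlgebra.exists_eq_star_mul_self {A : Type*} [CStarAlgebra A] [PartialOrder A]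
    [StarOrderedRing A] {a : A} (ha : 0 ≤ a) : ∃ b, a = star b * b :=
  CStarAlgebra.nonneg_iff_eq_star_mul_self.1 ha

theorem CStarMatrix.exists_eq_sum_star_mul {A : Type*} [CStarAlgebra A] [PartialOrder A]
    [StarOrderedRing A] {n : ℕ} {M : CStarMatrix (Fin n) (Fin n) A} (hM : 0 ≤ M) :
    ∃ N : Fin n → Fin n → A, ∀ i j, M i j = ∑ k, star (N k i) * N k j := by
  obtain ⟨N, rfl⟩ := CStarAlgebra.exists_eq_star_mul_self hM
  exact ⟨N, fun i j => by simp [CStarMatrix.mul_apply, CStarMatrix.star_apply]⟩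

/-! ### The unital completely positive map on the minimal tensor product -/

section TensorMap

variable {A B H K : Type*} [CStarAlgebra A] [PartialOrder A] [StarOrderedRing A]
  [CStarAlgebra B] [PartialOrder B] [StarOrderedRing B]
  [NormedAddCommGroup H] [InnerProductSpace ℂ H] [CompleteSpace H]
  [NormedAddCommGroup K] [InnerProductSpace ℂ K] [CompleteSpace K]
  {π : A →⋆ₐ[ℂ] (H →L[ℂ] H)} {ρ : B →⋆ₐ[ℂ] (K →L[ℂ] K)}

namespace MinTensor

theorem norm_ofAlg_map_le (hπ : Function.Injective π) (hρ : Function.Injective ρ)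
    {T : A →CP A} (hT : T 1 = 1) {R : B →CP B} (hR : R 1 = 1) (z : A ⊗[ℂ] B) :
    ‖ofAlg π ρ (TensorProduct.map (T : A →ₗ[ℂ] A) (R : B →ₗ[ℂ] B) z)‖ ≤ ‖ofAlg π ρ z‖ := by
  -- A strict upper bound `c` is positive even when the norm vanishes, as the block criterion
  -- requires.
  refine le_of_forall_gt_imp_ge_of_dense fun c hc => ?_
  have hc0 : 0 < c := (norm_nonneg _).trans_lt hc
  have hone (p : HilbertTensor H K) :
      ((c : ℂ) • (1 : HilbertTensor H K →L[ℂ] HilbertTensor H K)) p = (c : ℂ) • p := rfl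
  have hmap : TensorProduct.map (T : A →ₗ[ℂ] A) (R : B →ₗ[ℂ] B) 1 = 1 := by
    rw [Algebra.TensorProduct.one_def, TensorProduct.map_tmul]
    simp [hT, hR]
  -- The block matrix with diagonal `c` and corners `z`, `star z` is positive since `‖z‖ ≤ c`.
  -- Unitality keeps the diagonal unchanged.
  have halg := sum_inner_map_nonneg hπ hρ T R
    ![![(c : ℂ) • 1, z], ![star z, (c : ℂ) • 1]] (fun u => by
      simp only [Fin.sum_univ_two, Matrix.cons_val_zero, Matrix.cons_val_one, map_smul, ofAlg_one,
        ofAlg_star, map_one, map_star, ContinuousLinearMap.star_eq_adjoint,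
        ContinuousLinearMap.adjoint_inner_right, hone, inner_smul_right]
      exact ContinuousLinearMap.block_nonneg ((norm_val π ρ _).trans_le hc.le) _ _)
  simp only [Fin.sum_univ_two, Matrix.cons_val_zero, Matrix.cons_val_one, map_smul, ofAlg_one,
    map_one, hmap, hone, inner_smul_right] at halg
  rw [← norm_val]
  refine ContinuousLinearMap.opNorm_le_of_block_nonneg (S' := val π ρ (ofAlg π ρ
    (TensorProduct.map (T : A →ₗ[ℂ] A) (R : B →ₗ[ℂ] B) (star z)))) hc0 fun u v => ?_
  refine isClosed_property2 HilbertTensor.denseRange_incl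
    (p := fun u v => 0 ≤ (c : ℂ) * ⟪u, u⟫_ℂ + ⟪u, val π ρ _ v⟫_ℂ +
      (⟪v, val π ρ _ u⟫_ℂ + (c : ℂ) * ⟪v, v⟫_ℂ)) ?_ (fun u v => ?_) u v
  · exact isClosed_le continuous_const (by fun_prop)
  · exact halg ![u, v]

/-- The extension of `T ⊗ R` to the minimal tensor product as a bounded operator. -/
noncomputable def mapL (π : A →⋆ₐ[ℂ] (H →L[ℂ] H)) (ρ : B →⋆ₐ[ℂ] (K →L[ℂ] K))
    (T : A →ₗ[ℂ] A) (R : B →ₗ[ℂ] B) : MinTensor π ρ →L[ℂ] MinTensor π ρ :=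
  (ofAlg π ρ ∘ₗ TensorProduct.map T R).extendOfNorm (ofAlg π ρ)

omit [PartialOrder A] [StarOrderedRing A] [PartialOrder B] [StarOrderedRing B] in
theorem mapL_ofAlg {T : A →ₗ[ℂ] A} {R : B →ₗ[ℂ] B}
    (h : ∀ z, ‖ofAlg π ρ (TensorProduct.map T R z)‖ ≤ ‖ofAlg π ρ z‖) (z : A ⊗[ℂ] B) :
    mapL π ρ T R (ofAlg π ρ z) = ofAlg π ρ (TensorProduct.map T R z) :=
  LinearMap.extendOfNorm_eq (denseRange_ofAlg π ρ) ⟨1, fun z => by simpa using h z⟩ z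

omit [PartialOrder A] [StarOrderedRing A] [PartialOrder B] [StarOrderedRing B] in
theorem norm_mapL_apply_le {T : A →ₗ[ℂ] A} {R : B →ₗ[ℂ] B}
    (h : ∀ z, ‖ofAlg π ρ (TensorProduct.map T R z)‖ ≤ ‖ofAlg π ρ z‖) (w : MinTensor π ρ) :
    ‖mapL π ρ T R w‖ ≤ ‖w‖ := by
  simpa using! LinearMap.norm_extendOfNorm_apply_le (denseRange_ofAlg π ρ) 1
    (fun z => by simpa using h z) w

omit [PartialOrder A] [StarOrderedRing A] [PartialOrder B] [StarOrderedRing B] in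
theorem isTensorMap_mapL {T : A →ₗ[ℂ] A} {R : B →ₗ[ℂ] B}
    (h : ∀ z, ‖ofAlg π ρ (TensorProduct.map T R z)‖ ≤ ‖ofAlg π ρ z‖) :
    IsTensorMap π ρ T R (mapL π ρ T R) := fun a b => by
  rw [← ofAlg_tmul, mapL_ofAlg h, TensorProduct.map_tmul, ofAlg_tmul]

theorem sum_inner_mapL_ofAlg_nonneg (hπ : Function.Injective π) (hρ : Function.Injective ρ)
    {T : A →CP A} (hT : T 1 = 1) {R : B →CP B} (hR : R 1 = 1) {n : ℕ}
    (y : Fin n → Fin n → A ⊗[ℂ] B) (u : Fin n → H ⊗[ℂ] K) :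
    0 ≤ ∑ i, ∑ j, ⟪HilbertTensor.incl H K (u i), val π ρ (mapL π ρ (T : A →ₗ[ℂ] A) (R : B →ₗ[ℂ] B)
      (∑ k, star (ofAlg π ρ (y k i)) * ofAlg π ρ (y k j))) (HilbertTensor.incl H K (u j))⟫_ℂ := by
  have hJ (i j : Fin n) : ∑ k, star (ofAlg π ρ (y k i)) * ofAlg π ρ (y k j) =
      ofAlg π ρ (∑ k, star (y k i) * y k j) := by
    simp only [ofAlg_mul, ofAlg_star, map_sum]
  simp only [hJ, mapL_ofAlg (norm_ofAlg_map_le hπ hρ hT hR)]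
  refine sum_inner_map_nonneg hπ hρ T R (fun i j => ∑ k, star (y k i) * y k j) (fun u => ?_) u
  have := sum_inner_sum_star_mul (fun i j => val π ρ (ofAlg π ρ (y i j)))
    (fun i => HilbertTensor.incl H K (u i))
  simp only [← hJ, map_sum, map_mul, map_star]
  rw [this]
  exact Finset.sum_nonneg fun k _ => by
    rw [inner_self_eq_ofReal_norm_sq]
    exact Complex.zero_le_real.2 (sq_nonneg _)

theorem sum_inner_mapL_nonneg (hπ : Function.Injective π) (hρ : Function.Injective ρ)
    {T : A →CP A} (hT : T 1 = 1) {R : B →CP B} (hR : R 1 = 1) {n : ℕ}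
    (N : Fin n → Fin n → MinTensor π ρ) (v : Fin n → HilbertTensor H K) :
    0 ≤ ∑ i, ∑ j, ⟪v i, val π ρ (mapL π ρ (T : A →ₗ[ℂ] A) (R : B →ₗ[ℂ] B)
      (∑ k, star (N k i) * N k j)) (v j)⟫_ℂ := by
  have hcont : Continuous fun z : MinTensor π ρ =>
      val π ρ (mapL π ρ (T : A →ₗ[ℂ] A) (R : B →ₗ[ℂ] B) z) :=
    (map_continuous (val π ρ)).comp (mapL π ρ (T : A →ₗ[ℂ] A) (R : B →ₗ[ℂ] B)).continuous
  exact sum_inner_sum_star_mul_nonneg_of_dense hcont (denseRange_ofAlg π ρ)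
    HilbertTensor.denseRange_incl (sum_inner_mapL_ofAlg_nonneg hπ hρ hT hR) N v

/-- The tensor product of two unital completely positive maps. -/
noncomputable def mapCP (hπ : Function.Injective π) (hρ : Function.Injective ρ)
    {T : A →CP A} (hT : T 1 = 1) {R : B →CP B} (hR : R 1 = 1) :
    MinTensor π ρ →CP MinTensor π ρ where
  toLinearMap := (mapL π ρ (T : A →ₗ[ℂ] A) (R : B →ₗ[ℂ] B)).toLinearMap
  map_cstarMatrix_nonneg' n M hM := by
    rw [cstarMatrix_nonneg_iff (val_injective π ρ)]
    intro v
    obtain ⟨N, hN⟩ := CStarMatrix.exists_eq_sum_star_mul hM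
    have := sum_inner_mapL_nonneg hπ hρ hT hR N v
    simp only [← hN] at this
    exact this

theorem mapCP_apply (hπ : Function.Injective π) (hρ : Function.Injective ρ)
    {T : A →CP A} (hT : T 1 = 1) {R : B →CP B} (hR : R 1 = 1) (w : MinTensor π ρ) :
    mapCP hπ hρ hT hR w = mapL π ρ (T : A →ₗ[ℂ] A) (R : B →ₗ[ℂ] B) w := rfl

theorem mapCP_one (hπ : Function.Injective π) (hρ : Function.Injective ρ)
    {T : A →CP A} (hT : T 1 = 1) {R : B →CP B} (hR : R 1 = 1) :
    mapCP (π := π) (ρ := ρ) hπ hρ hT hR 1 = 1 := by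
  rw [mapCP_apply, ← tmul_one_one, isTensorMap_mapL (norm_ofAlg_map_le hπ hρ hT hR)]
  simp [hT, hR]

end MinTensor

end TensorMap

/-! ### Strong Cesàro convergence of scalar sequences -/

section StrongCesaro

open Filter Topology

/-- Strong Cesàro convergence: the averages of the distances to the limit tend to zero. -/
def StrongCesaro (u : ℕ → ℂ) (l : ℂ) : Prop :=
  Tendsto (fun n : ℕ => (n : ℝ)⁻¹ * ∑ k ∈ Finset.range n, ‖u k - l‖) atTop (𝓝 0)

namespace StrongCesaro

variable {u v : ℕ → ℂ} {l m : ℂ}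

theorem average_nonneg (w : ℕ → ℂ) (n : ℕ) :
    0 ≤ (n : ℝ)⁻¹ * ∑ k ∈ Finset.range n, ‖w k‖ := by positivity

theorem average_le_of_le {f g : ℕ → ℝ} (h : ∀ k, f k ≤ g k) (n : ℕ) :
    (n : ℝ)⁻¹ * ∑ k ∈ Finset.range n, f k ≤ (n : ℝ)⁻¹ * ∑ k ∈ Finset.range n, g k := by
  gcongr
  exact h _

theorem of_norm_sub_le {a b : ℝ} (hu : StrongCesaro u l) (hv : StrongCesaro v m) {w : ℕ → ℂ} {p : ℂ}
    (h : ∀ k, ‖w k - p‖ ≤ a * ‖u k - l‖ + b * ‖v k - m‖) : StrongCesaro w p := by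
  refine squeeze_zero (fun n => average_nonneg _ n) (fun n => average_le_of_le h n) ?_
  have := (hu.const_mul a).add (hv.const_mul b)
  simp only [mul_zero, add_zero] at this
  refine this.congr fun n => ?_
  rw [Finset.sum_add_distrib, ← Finset.mul_sum, ← Finset.mul_sum]
  ring

theorem const (l : ℂ) : StrongCesaro (fun _ => l) l := by simp [StrongCesaro]

theorem add (hu : StrongCesaro u l) (hv : StrongCesaro v m) :
    StrongCesaro (fun k => u k + v k) (l + m) :=
  of_norm_sub_le (a := 1) (b := 1) hu hv fun k => by
    rw [one_mul, one_mul, add_sub_add_comm]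
    exact norm_add_le _ _

theorem mul {C : ℝ} (hu : StrongCesaro u l) (hv : StrongCesaro v m) (hC : ∀ k, ‖v k‖ ≤ C) :
    StrongCesaro (fun k => u k * v k) (l * m) :=
  of_norm_sub_le (a := C) (b := ‖l‖) hu hv fun k => by
    -- Only one sequence has to be bounded, since the other factor is replaced by its limit.
    have : u k * v k - l * m = v k * (u k - l) + l * (v k - m) := by ring
    rw [this]
    refine (norm_add_le _ _).trans ?_
    rw [norm_mul, norm_mul]
    gcongr
    exact hC k

theorem const_mul (c : ℂ) (hu : StrongCesaro u l) : StrongCesaro (fun k => c * u k) (c * l) :=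
  of_norm_sub_le (a := ‖c‖) (b := 0) hu hu fun k => by
    rw [← mul_sub, norm_mul, zero_mul, add_zero]

theorem nonpos_of_le (hu : StrongCesaro u l) {δ : ℝ} (h : ∀ k, δ ≤ ‖u k - l‖) : δ ≤ 0 := by
  refine ge_of_tendsto hu (eventually_atTop.2 ⟨1, fun n hn => ?_⟩)
  have hn' : (n : ℝ) ≠ 0 := by positivity
  calc δ = (n : ℝ)⁻¹ * ∑ _k ∈ Finset.range n, δ := by simp [hn']
    _ ≤ _ := average_le_of_le h n

theorem norm_le (hu : StrongCesaro u l) {C : ℝ} (h : ∀ k, ‖u k‖ ≤ C) : ‖l‖ ≤ C := by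
  have := hu.nonpos_of_le (δ := ‖l‖ - C) fun k => by
    have h1 := norm_sub_norm_le l (u k)
    rw [norm_sub_rev] at h1
    linarith [h k]
  linarith

theorem eq_of_const {c : ℂ} (h : StrongCesaro (fun _ => c) l) : c = l := by
  have := h.nonpos_of_le (δ := ‖c - l‖) fun _ => le_rfl
  exact sub_eq_zero.1 (norm_le_zero_iff.1 this)

/-- Closedness under uniform approximation: this is what permits both density arguments below, in
the algebra and in the dual. -/
theorem of_approx (h : ∀ ε > 0, ∃ u' l', StrongCesaro u' l' ∧ (∀ k, ‖u k - u' k‖ ≤ ε) ∧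
    ‖l - l'‖ ≤ ε) : StrongCesaro u l := by
  rw [StrongCesaro, Metric.tendsto_atTop]
  intro ε hε
  obtain ⟨u', l', hu', hk, hl⟩ := h (ε / 4) (by positivity)
  obtain ⟨N, hN⟩ := Metric.tendsto_atTop.1 hu' (ε / 4) (by positivity)
  refine ⟨N + 1, fun n hn => ?_⟩
  have hn' : (n : ℝ) ≠ 0 := by
    have : 0 < n := by omega
    positivity
  have h1 := hN n (by omega)
  rw [Real.dist_0_eq_abs, abs_of_nonneg (average_nonneg _ n)] at h1 ⊢
  have h2 := average_le_of_le (f := fun k => ‖u k - l‖)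
    (g := fun k => ‖u' k - l'‖ + (ε / 4 + ε / 4)) (fun k => by
      have h3 : u k - l = (u' k - l') + ((u k - u' k) - (l - l')) := by ring
      rw [h3]
      refine (norm_add_le _ _).trans ?_
      gcongr
      exact (norm_sub_le _ _).trans (add_le_add (hk k) hl)) n
  rw [Finset.sum_add_distrib, mul_add] at h2
  simp only [Finset.sum_const, Finset.card_range, nsmul_eq_mul, inv_mul_cancel_left₀ hn'] at h2
  linarith

theorem unique (hu : StrongCesaro u l) (hu' : StrongCesaro u m) : l = m := by
  have h := hu.add (hu'.const_mul (-1))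
  have h0 : (fun k => u k + -1 * u k) = fun _ => (0 : ℂ) := by ext; ring
  rw [h0] at h
  linear_combination -h.eq_of_const

theorem tendsto_average_error (hu : StrongCesaro u l) (C : ℝ) :
    Tendsto (fun n : ℕ => (n : ℝ)⁻¹ * (∑ k ∈ Finset.range n, ‖u k - l‖ + (C + ‖l‖)))
      atTop (𝓝 0) := by
  have h1 := (tendsto_inv_atTop_nhds_zero_nat (𝕜 := ℝ)).mul_const (C + ‖l‖)
  simpa [mul_add] using Tendsto.add hu h1

/-- Ergodic averages run over `1, …, n` and mixing averages over `0, …, n - 1`. The discrepancy is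
one bounded term, negligible after division by `n`. -/
theorem sum_Icc_norm_sub_le {C : ℝ} (h : ∀ k, ‖u k‖ ≤ C) (n : ℕ) :
    ∑ k ∈ Finset.Icc 1 n, ‖u k - l‖ ≤ ∑ k ∈ Finset.range n, ‖u k - l‖ + (C + ‖l‖) := by
  calc ∑ k ∈ Finset.Icc 1 n, ‖u k - l‖ ≤ ∑ k ∈ Finset.range (n + 1), ‖u k - l‖ :=
      Finset.sum_le_sum_of_subset_of_nonneg (fun k hk => by
        rw [Finset.mem_Icc] at hk
        exact Finset.mem_range.2 (by omega)) fun _ _ _ => norm_nonneg _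
    _ = ∑ k ∈ Finset.range n, ‖u k - l‖ + ‖u n - l‖ := Finset.sum_range_succ _ _
    _ ≤ _ := by
      gcongr
      exact (norm_sub_le _ _).trans (by gcongr; exact h n)

theorem tendsto_average (hu : StrongCesaro u l) {C : ℝ} (h : ∀ k, ‖u k‖ ≤ C) :
    Tendsto (fun n : ℕ => (n : ℂ)⁻¹ * ∑ k ∈ Finset.Icc 1 n, u k) atTop (𝓝 l) := by
  rw [tendsto_iff_norm_sub_tendsto_zero]
  refine squeeze_zero' (Eventually.of_forall fun n => norm_nonneg _)
    (eventually_atTop.2 ⟨1, fun n hn => ?_⟩) (hu.tendsto_average_error C)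
  have hn' : (n : ℂ) ≠ 0 := by exact_mod_cast (by omega : n ≠ 0)
  have heq : (n : ℂ)⁻¹ * ∑ k ∈ Finset.Icc 1 n, u k - l =
      (n : ℂ)⁻¹ * ∑ k ∈ Finset.Icc 1 n, (u k - l) := by
    rw [Finset.sum_sub_distrib, mul_sub]
    simp [hn']
  rw [heq, norm_mul, norm_inv, Complex.norm_natCast]
  gcongr
  exact (norm_sum_le _ _).trans (sum_Icc_norm_sub_le h n)

theorem shift (hu : StrongCesaro u l) {C : ℝ} (h : ∀ k, ‖u k‖ ≤ C) :
    StrongCesaro (fun k => u (k + 1)) l := by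
  refine squeeze_zero (fun n => average_nonneg _ n) (fun n => ?_) (hu.tendsto_average_error C)
  gcongr
  refine le_trans (le_of_eq ?_) (sum_Icc_norm_sub_le h n)
  rw [Finset.range_eq_Ico, Finset.sum_Ico_add' (fun k => ‖u k - l‖) 0 n 1]
  rfl

variable {M : Type*} [NormedAddCommGroup M] [NormedSpace ℂ M] {Φ : M → M} {E : M → M}

theorem of_denseRange (hΦ : ∀ k w w', ‖Φ^[k] w - Φ^[k] w'‖ ≤ ‖w - w'‖)
    (hE : ∀ w w', ‖E w - E w'‖ ≤ ‖w - w'‖) {X : Type*} {J : X → M} (hJ : DenseRange J)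
    {f : M →L[ℂ] ℂ} (h : ∀ x, StrongCesaro (fun k => f (Φ^[k] (J x))) (f (E (J x)))) (w : M) :
    StrongCesaro (fun k => f (Φ^[k] w)) (f (E w)) := by
  refine of_approx fun ε hε => ?_
  have hf : 0 < ‖f‖ + 1 := by positivity
  obtain ⟨x, hx⟩ := hJ.exists_dist_lt w (div_pos hε hf)
  rw [dist_eq_norm, lt_div_iff₀ hf] at hx
  have hbound (v : M) (hv : ‖v‖ ≤ ‖w - J x‖) : ‖f v‖ ≤ ε := by
    calc ‖f v‖ ≤ ‖f‖ * ‖v‖ := f.le_opNorm v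
      _ ≤ (‖f‖ + 1) * ‖w - J x‖ := by gcongr; linarith
      _ ≤ ε := by linarith
  refine ⟨_, _, h x, fun k => ?_, ?_⟩
  · rw [← map_sub]
    exact hbound _ (hΦ k _ _)
  · rw [← map_sub]
    exact hbound _ (hE _ _)

theorem of_mem_closure {w : M} (hΦ : ∀ k, ‖Φ^[k] w‖ ≤ ‖w‖) (hE : ‖E w‖ ≤ ‖w‖)
    {S : Set (M →L[ℂ] ℂ)} (h : ∀ f ∈ S, StrongCesaro (fun k => f (Φ^[k] w)) (f (E w)))
    {f : M →L[ℂ] ℂ} (hf : f ∈ closure S) : StrongCesaro (fun k => f (Φ^[k] w)) (f (E w)) := by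
  refine of_approx fun ε hε => ?_
  have hw : 0 < ‖w‖ + 1 := by positivity
  obtain ⟨g, hg, hfg⟩ := Metric.mem_closure_iff.1 hf _ (div_pos hε hw)
  rw [dist_eq_norm, lt_div_iff₀ hw] at hfg
  have hbound (v : M) (hv : ‖v‖ ≤ ‖w‖) : ‖f v - g v‖ ≤ ε := by
    calc ‖f v - g v‖ ≤ ‖f - g‖ * ‖v‖ := (f - g).le_opNorm v
      _ ≤ ‖f - g‖ * (‖w‖ + 1) := by gcongr; linarith
      _ ≤ ε := hfg.le
  exact ⟨_, _, h g hg, fun k => hbound _ (hΦ k), hbound _ hE⟩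

end StrongCesaro

end StrongCesaro

/-! ### States span the dual -/

section States

open scoped Pointwise

variable {A H : Type*} [CStarAlgebra A]
  [NormedAddCommGroup H] [InnerProductSpace ℂ H] [CompleteSpace H]

/-- Positivity of a functional on a C⋆-algebra. -/
def IsPositiveFunctional (φ : A →L[ℂ] ℂ) : Prop :=
  ∀ x : A, 0 ≤ φ (star x * x)

theorem isPositiveFunctional_iff {φ : A →L[ℂ] ℂ} : IsPositiveFunctional φ ↔
    ∀ x : A, 0 ≤ (φ (star x * x)).re ∧ (φ (star x * x)).im = 0 := by
  simp only [IsPositiveFunctional, Complex.nonneg_iff, eq_comm]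

theorem isPositiveFunctional_vectorFunctional (π : A →⋆ₐ[ℂ] (H →L[ℂ] H)) (x : H) :
    IsPositiveFunctional (vectorFunctional π x x) := fun a => by
  rw [vectorFunctional_apply, map_mul, map_star, mul_apply_eq_comp,
    ContinuousLinearMap.star_eq_adjoint, ContinuousLinearMap.adjoint_inner_right,
    inner_self_eq_ofReal_norm_sq]
  exact Complex.zero_le_real.2 (sq_nonneg _)

theorem isState_vectorFunctional (π : A →⋆ₐ[ℂ] (H →L[ℂ] H)) {x : H} (hx : ‖x‖ = 1) :
    IsState (vectorFunctional π x x) where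
  nonneg := isPositiveFunctional_iff.1 (isPositiveFunctional_vectorFunctional π x)
  map_one := by simp [hx]

namespace IsPositiveFunctional

variable {φ : A →L[ℂ] ℂ}

theorem map_one_nonneg (h : IsPositiveFunctional φ) : 0 ≤ φ 1 := by simpa using h 1

theorem norm_apply_le_of_isSelfAdjoint (h : IsPositiveFunctional φ) {x : A}
    (hx : IsSelfAdjoint x) : ‖φ x‖ ≤ (φ 1).re * ‖x‖ := by
  let : PartialOrder A := CStarAlgebra.spectralOrder A
  have : StarOrderedRing A := CStarAlgebra.spectralOrderedRing A
  have hpos {y : A} (hy : 0 ≤ y) : 0 ≤ φ y := by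
    obtain ⟨b, rfl⟩ := CStarAlgebra.exists_eq_star_mul_self hy
    exact h b
  have h1 := hpos (sub_nonneg.2 hx.le_algebraMap_norm_self)
  have h2 := hpos (sub_nonneg.2 hx.neg_algebraMap_norm_le_self)
  have h3 := h.map_one_nonneg
  simp only [Algebra.algebraMap_eq_smul_one, map_sub, map_neg, ← Complex.coe_smul, map_smul,
    smul_eq_mul] at h1 h2
  rw [Complex.nonneg_iff] at h1 h2 h3
  simp only [Complex.sub_re, Complex.sub_im, Complex.neg_re, Complex.neg_im, Complex.mul_re,
    Complex.mul_im, Complex.ofReal_re, Complex.ofReal_im, ← h3.2] at h1 h2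
  have him : (φ x).im = 0 := by linarith [h1.2]
  have hx' : φ x = ((φ x).re : ℂ) := Complex.ext rfl him
  rw [hx', Complex.norm_real, Real.norm_eq_abs, abs_le]
  constructor <;> linarith [h1.1, h2.1]

theorem norm_apply_le (h : IsPositiveFunctional φ) (x : A) :
    ‖φ x‖ ≤ 2 * (φ 1).re * ‖x‖ := by
  have h1 := h.norm_apply_le_of_isSelfAdjoint (realPart x).2
  have h2 := h.norm_apply_le_of_isSelfAdjoint (imaginaryPart x).2
  have h3 : 0 ≤ (φ 1).re := (Complex.nonneg_iff.1 h.map_one_nonneg).1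
  have h4 : ‖(realPart x : A)‖ ≤ ‖x‖ := realPart.norm_le x
  have h5 : ‖(imaginaryPart x : A)‖ ≤ ‖x‖ := imaginaryPart.norm_le x
  calc ‖φ x‖ = ‖φ (realPart x) + Complex.I * φ (imaginaryPart x)‖ := by
        conv_lhs => rw [← realPart_add_I_smul_imaginaryPart x]
        rw [map_add, map_smul, smul_eq_mul]
    _ ≤ ‖φ (realPart x)‖ + ‖φ (imaginaryPart x)‖ := by
        refine (norm_add_le _ _).trans ?_
        rw [norm_mul, Complex.norm_I, one_mul]
    _ ≤ (φ 1).re * ‖x‖ + (φ 1).re * ‖x‖ := by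
        refine add_le_add (h1.trans ?_) (h2.trans ?_) <;> gcongr
    _ = _ := by ring

/-- Normalise by `φ 1`; if `φ 1 = 0`, the norm estimate gives `φ = 0`. -/
theorem mem_span_isState (h : IsPositiveFunctional φ) :
    φ ∈ Submodule.span ℂ {ψ : A →L[ℂ] ℂ | IsState ψ} := by
  have h1 := h.map_one_nonneg
  obtain ⟨r, hr, hφ⟩ : ∃ r : ℝ, 0 ≤ r ∧ φ 1 = r :=
    ⟨(φ 1).re, (Complex.nonneg_iff.1 h1).1, Complex.ext rfl (Complex.nonneg_iff.1 h1).2.symm⟩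
  rcases hr.eq_or_lt with rfl | hr
  · have : φ = 0 := by
      ext x
      simpa [hφ] using h.norm_apply_le x
    rw [this]
    exact zero_mem _
  · have hr' : (r : ℂ) ≠ 0 := by exact_mod_cast hr.ne'
    have : φ = (r : ℂ) • ((r : ℂ)⁻¹ • φ) := by rw [smul_inv_smul₀ hr']
    rw [this]
    refine Submodule.smul_mem _ _ (Submodule.subset_span ⟨isPositiveFunctional_iff.1 fun x => ?_, ?_⟩)
    · rw [← Complex.ofReal_inv]
      exact mul_nonneg (Complex.zero_le_real.2 (inv_nonneg.2 hr.le)) (h x)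
    · change (r : ℂ)⁻¹ * φ 1 = 1
      rw [hφ, inv_mul_cancel₀ hr']

end IsPositiveFunctional

omit [CompleteSpace H] in
-- Polarization with `‖x‖ = ‖y‖`: four terms of size `w * (2 * ‖y‖) ^ 2`, divided by four. Then take
-- `x` parallel to `S y`.
theorem ContinuousLinearMap.opNorm_le_of_norm_inner_self_le {S : H →L[ℂ] H} {w : ℝ} (hw : 0 ≤ w)
    (h : ∀ x, ‖⟪S x, x⟫_ℂ‖ ≤ w * ‖x‖ ^ 2) : ‖S‖ ≤ 4 * w := by
  refine ContinuousLinearMap.opNorm_le_bound _ (by positivity) fun y => ?_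
  rcases eq_or_ne (S y) 0 with h0 | h0
  · rw [h0, norm_zero]
    positivity
  have hpol (x : H) (hx : ‖x‖ = ‖y‖) : ‖⟪S y, x⟫_ℂ‖ ≤ 4 * w * ‖y‖ ^ 2 := by
    have hb (c : ℂ) (hc : ‖c‖ = 1) : ‖⟪S (x + c • y), x + c • y⟫_ℂ‖ ≤ w * (2 * ‖y‖) ^ 2 := by
      refine (h _).trans ?_
      gcongr
      refine (norm_add_le _ _).trans ?_
      rw [norm_smul, hc, hx]
      linarith
    have h1 := hb 1 (by simp)
    have h2 := hb (-1) (by simp)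
    have h3 := hb Complex.I (by simp)
    have h4 := hb (-Complex.I) (by simp)
    simp only [one_smul, neg_smul, ← sub_eq_add_neg] at h1 h2 h3 h4
    have := inner_map_polarization S.toLinearMap x y
    simp only [ContinuousLinearMap.coe_coe] at this
    rw [this, norm_div, Complex.norm_ofNat, div_le_iff₀ (by norm_num)]
    refine (norm_sub_le _ _).trans ?_
    have h5 := (norm_add_le (⟪S (x + y), x + y⟫_ℂ - ⟪S (x - y), x - y⟫_ℂ)
      (Complex.I * ⟪S (x + Complex.I • y), x + Complex.I • y⟫_ℂ))
    have h6 := norm_sub_le ⟪S (x + y), x + y⟫_ℂ ⟪S (x - y), x - y⟫_ℂ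
    simp only [norm_mul, Complex.norm_I, one_mul] at h5 ⊢
    nlinarith
  have hSy : 0 < ‖S y‖ := norm_pos_iff.2 h0
  have hy : 0 < ‖y‖ := norm_pos_iff.2 fun hy => h0 (by rw [hy, map_zero])
  have h1 := hpol (((‖y‖ / ‖S y‖ : ℝ) : ℂ) • S y) (by
    rw [norm_smul, Complex.norm_real, Real.norm_of_nonneg (by positivity)]
    field_simp)
  rw [inner_smul_right, inner_self_eq_ofReal_norm_sq, ← Complex.ofReal_mul, Complex.norm_real,
    Real.norm_of_nonneg (by positivity)] at h1
  have h2 : ‖y‖ / ‖S y‖ * ‖S y‖ ^ 2 = ‖y‖ * ‖S y‖ := by field_simp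
  rw [h2] at h1
  nlinarith

theorem norm_le_of_norm_vectorFunctional_le {π : A →⋆ₐ[ℂ] (H →L[ℂ] H)}
    (hπ : Function.Injective π) {a : A} {w : ℝ} (hw : 0 ≤ w)
    (h : ∀ x, ‖x‖ = 1 → ‖vectorFunctional π x x a‖ ≤ w) : ‖a‖ ≤ 4 * w := by
  rw [← NonUnitalStarAlgHom.norm_map π hπ a]
  refine ContinuousLinearMap.opNorm_le_of_norm_inner_self_le hw fun x => ?_
  rcases eq_or_ne x 0 with rfl | hx
  · simp
  have hx' : 0 < ‖x‖ := norm_pos_iff.2 hx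
  have h1 := h (((‖x‖⁻¹ : ℝ) : ℂ) • x) (by
    rw [norm_smul, Complex.norm_real, Real.norm_of_nonneg (by positivity)]
    exact inv_mul_cancel₀ hx'.ne')
  rw [vectorFunctional_apply, map_smul, inner_smul_left, inner_smul_right, norm_mul, norm_mul,
    Complex.conj_ofReal, Complex.norm_real, Real.norm_of_nonneg (by positivity)] at h1
  rw [norm_inner_symm]
  calc ‖⟪x, π a x⟫_ℂ‖ = ‖x‖⁻¹ * (‖x‖⁻¹ * ‖⟪x, π a x⟫_ℂ‖) * ‖x‖ ^ 2 := by field_simp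
    _ ≤ w * ‖x‖ ^ 2 := by gcongr

variable (A) in
/-- The positive functionals of norm at most one, with the weak⋆ topology. -/
def quasiState : Set (WeakDual ℂ A) :=
  {φ | (∀ x : A, 0 ≤ φ (star x * x)) ∧ (φ 1).re ≤ 1}

theorem quasiState_convex : Convex ℝ (quasiState A) := by
  intro φ hφ ψ hψ a b ha hb hab
  refine ⟨fun x => ?_, ?_⟩
  · exact add_nonneg (smul_nonneg ha (hφ.1 x)) (smul_nonneg hb (hψ.1 x))
  · change (a • φ 1 + b • ψ 1).re ≤ 1
    rw [Complex.add_re, Complex.smul_re, Complex.smul_re, smul_eq_mul, smul_eq_mul]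
    nlinarith [hφ.2, hψ.2]

theorem quasiState_isCompact : IsCompact (quasiState A) := by
  refine (WeakDual.isCompact_closedBall (𝕜 := ℂ) (0 : StrongDual ℂ A) 2).of_isClosed_subset ?_ ?_
  · refine IsClosed.inter (s₁ := {φ : WeakDual ℂ A | ∀ x : A, 0 ≤ φ (star x * x)})
      (s₂ := {φ : WeakDual ℂ A | (φ 1).re ≤ 1}) ?_ ?_
    · rw [Set.ofPred_forall]
      exact isClosed_iInter fun x => isClosed_le continuous_const (WeakDual.eval_continuous _)
    · exact isClosed_le (Complex.continuous_re.comp (WeakDual.eval_continuous _)) continuous_const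
  · intro φ hφ
    have hpos : IsPositiveFunctional (WeakDual.toStrongDual φ) := hφ.1
    rw [Set.mem_preimage, mem_closedBall_zero_iff]
    refine ContinuousLinearMap.opNorm_le_bound _ (by norm_num) fun x => ?_
    refine (hpos.norm_apply_le x).trans ?_
    have : ((WeakDual.toStrongDual φ) 1).re ≤ 1 := hφ.2
    gcongr
    linarith

theorem zero_mem_quasiState : (0 : WeakDual ℂ A) ∈ quasiState A :=
  ⟨fun _ => le_rfl, zero_le_one⟩

/-- A Hahn–Banach substitute for Jordan decomposition. Combinations of four quasi-states form a
weak⋆ compact convex set. A functional outside it is separated by evaluation at some `x`, whose norm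
is controlled by its values on vector states. -/
theorem mem_span_isState_of_norm_le {π : A →⋆ₐ[ℂ] (H →L[ℂ] H)} (hπ : Function.Injective π)
    {f : A →L[ℂ] ℂ} (hf : ‖f‖ ≤ 1 / 8) : f ∈ Submodule.span ℂ {ψ : A →L[ℂ] ℂ | IsState ψ} := by
  set P := quasiState A
  set K : Set (WeakDual ℂ A) := (P - P) + Complex.I • (P - P) with hK
  have hKconv : Convex ℝ K := by
    refine (quasiState_convex.sub quasiState_convex).add ?_
    exact (quasiState_convex.sub quasiState_convex).is_linear_image
      ⟨fun x y => smul_add _ x y, fun c x => smul_comm _ c x⟩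
  have hsub : IsCompact (P - P) := by
    rw [sub_eq_add_neg]
    exact quasiState_isCompact.add quasiState_isCompact.neg
  have hKcomp : IsCompact K := hsub.add (hsub.smul _)
  have h0 := zero_mem_quasiState (A := A)
  by_cases hfK : StrongDual.toWeakDual f ∈ K
  · have hP (φ : WeakDual ℂ A) (hφ : φ ∈ P) : WeakDual.toStrongDual φ ∈
        Submodule.span ℂ {ψ : A →L[ℂ] ℂ | IsState ψ} :=
      IsPositiveFunctional.mem_span_isState hφ.1
    obtain ⟨_, ⟨φ₁, h₁, φ₂, h₂, rfl⟩, _, ⟨_, ⟨φ₃, h₃, φ₄, h₄, rfl⟩, rfl⟩, h⟩ := hfK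
    have : f = (WeakDual.toStrongDual φ₁ - WeakDual.toStrongDual φ₂) +
        Complex.I • (WeakDual.toStrongDual φ₃ - WeakDual.toStrongDual φ₄) := h.symm
    rw [this]
    exact add_mem (sub_mem (hP _ h₁) (hP _ h₂))
      (Submodule.smul_mem _ _ (sub_mem (hP _ h₃) (hP _ h₄)))
  · exfalso
    have : IsScalarTower ℝ ℂ (WeakDual ℂ A) :=
      inferInstanceAs (IsScalarTower ℝ ℂ (A →L[ℂ] ℂ))
    have hloc : LocallyConvexSpace ℝ (WeakDual ℂ A) := 
      WithSeminorms.toLocallyConvexSpace (WeakDual.withSeminorms ℂ A)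
    obtain ⟨g, u, hg, hgf⟩ := @RCLike.geometric_hahn_banach_closed_point ℂ (WeakDual ℂ A)
      _ _ _ _ _ _ _ _ _ _ hloc hKconv hKcomp.isClosed hfK
    obtain ⟨x, rfl⟩ := LinearMap.dualEmbedding_surjective _ g
    have hg' (φ : WeakDual ℂ A) (hφ : φ ∈ K) : (φ x).re < u := hg φ hφ
    have hgf' : u < (f x).re := hgf
    have hu : 0 < u := by
      exact hg' 0 ⟨0, ⟨0, h0, 0, h0, sub_zero _⟩, 0,
        ⟨0, ⟨0, h0, 0, h0, sub_zero _⟩, smul_zero _⟩, add_zero _⟩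
    -- Since `0` is a quasi-state, `K` contains `±φ` and `±Iφ`, so the real and imaginary parts of
    -- `φ x` are both at most `u` in absolute value.
    have hbound (φ : WeakDual ℂ A) (hφ : φ ∈ P) : ‖φ x‖ ≤ 2 * u := by
      have hs1 : φ ∈ P - P := ⟨φ, hφ, 0, h0, sub_zero _⟩
      have hs2 : -φ ∈ P - P := ⟨0, h0, φ, hφ, zero_sub _⟩
      have hs0 : 0 ∈ P - P := ⟨0, h0, 0, h0, sub_zero _⟩
      have h1 := hg' φ ⟨φ, hs1, 0, ⟨0, hs0, smul_zero _⟩, add_zero _⟩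
      have h2 := hg' (-φ) ⟨-φ, hs2, 0, ⟨0, hs0, smul_zero _⟩, add_zero _⟩
      have h3 := hg' (Complex.I • φ) ⟨0, hs0, _, ⟨φ, hs1, rfl⟩, zero_add _⟩
      have h4 := hg' (Complex.I • -φ) ⟨0, hs0, _, ⟨-φ, hs2, rfl⟩, zero_add _⟩
      change (-(φ x)).re < u at h2
      change (Complex.I * φ x).re < u at h3
      change (Complex.I * -(φ x)).re < u at h4
      simp at h2 h3 h4
      refine (Complex.norm_le_abs_re_add_abs_im _).trans ?_
      have h5 := abs_le.2 ⟨by linarith, h1.le⟩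
      have h6 : |(φ x).im| ≤ u := abs_le.2 ⟨by linarith, by linarith⟩
      linarith
    have hx : ‖x‖ ≤ 4 * (2 * u) :=
      norm_le_of_norm_vectorFunctional_le hπ (by positivity) fun y hy =>
        hbound (StrongDual.toWeakDual (vectorFunctional π y y))
          ⟨isPositiveFunctional_vectorFunctional π y,
            by
              change (vectorFunctional π y y 1).re ≤ 1
              rw [(isState_vectorFunctional π hy).map_one]
              simp⟩
    -- Here `‖x‖ ≤ 8 * u`, so the radius `1 / 8` gives `‖f x‖ ≤ u`, against the separation.
    have h1 := (Complex.re_le_norm (f x)).trans (f.le_of_opNorm_le hf x)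
    linarith

theorem span_isState_eq_top {π : A →⋆ₐ[ℂ] (H →L[ℂ] H)} (hπ : Function.Injective π) :
    Submodule.span ℂ {ψ : A →L[ℂ] ℂ | IsState ψ} = ⊤ := by
  refine (Submodule.eq_top_iff').2 fun f => ?_
  have hc : (0 : ℝ) < 8 * (‖f‖ + 1) := by positivity
  have hc' : ((8 * (‖f‖ + 1) : ℝ) : ℂ) ≠ 0 := by exact_mod_cast hc.ne'
  rw [← Submodule.smul_mem_iff _ (inv_ne_zero hc')]
  refine mem_span_isState_of_norm_le hπ ?_
  rw [norm_smul, norm_inv, Complex.norm_real, Real.norm_of_nonneg hc.le,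
    inv_mul_le_iff₀ hc]
  linarith

end States

/-! ### Weak mixing along all functionals, and properties of the projection -/

section WeakMixing

variable {A H : Type*} [CStarAlgebra A]
  [NormedAddCommGroup H] [InnerProductSpace ℂ H] [CompleteSpace H]

theorem IsUniqueWeakMixing.strongCesaro {T : A → A} {E : A →L[ℂ] A} (h : IsUniqueWeakMixing T E)
    {π : A →⋆ₐ[ℂ] (H →L[ℂ] H)} (hπ : Function.Injective π) (f : A →L[ℂ] ℂ) (x : A) :
    StrongCesaro (fun k => f (T^[k] x)) (f (E x)) := by
  have hf : f ∈ Submodule.span ℂ {ψ : A →L[ℂ] ℂ | IsState ψ} := by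
    rw [span_isState_eq_top hπ]
    trivial
  induction hf using Submodule.span_induction with
  | mem φ hφ => exact h.tendsto φ hφ x
  | zero => exact StrongCesaro.const 0
  | add f g _ _ hf hg => exact hf.add hg
  | smul c f _ hf => exact hf.const_mul c

end WeakMixing

section Contraction

variable {A H : Type*} [CStarAlgebra A] [PartialOrder A] [StarOrderedRing A]
  [NormedAddCommGroup H] [InnerProductSpace ℂ H] [CompleteSpace H]
  {π : A →⋆ₐ[ℂ] (H →L[ℂ] H)}

theorem CompletelyPositiveMap.norm_apply_le (hπ : Function.Injective π) {T : A →CP A}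
    (hT : T 1 = 1) (a : A) : ‖T a‖ ≤ ‖a‖ := by
  refine le_of_forall_gt_imp_ge_of_dense fun c hc => ?_
  have hc0 : 0 < c := (norm_nonneg _).trans_lt hc
  have hone (p : H) : ((c : ℂ) • (1 : H →L[ℂ] H)) p = (c : ℂ) • p := rfl
  have hblock := T.sum_inner_nonneg hπ ![![(c : ℂ) • 1, a], ![star a, (c : ℂ) • 1]] (fun v => by
    simp only [Fin.sum_univ_two, Matrix.cons_val_zero, Matrix.cons_val_one, map_smul, map_one,
      map_star, ContinuousLinearMap.star_eq_adjoint, ContinuousLinearMap.adjoint_inner_right,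
      hone, inner_smul_right]
    exact ContinuousLinearMap.block_nonneg
      ((NonUnitalStarAlgHom.norm_map π hπ a).trans_le hc.le) _ _)
  simp only [Fin.sum_univ_two, Matrix.cons_val_zero, Matrix.cons_val_one, map_smul, map_one, hT,
    hone, inner_smul_right] at hblock
  rw [← NonUnitalStarAlgHom.norm_map π hπ]
  exact ContinuousLinearMap.opNorm_le_of_block_nonneg hc0 fun u v => hblock ![u, v]

theorem CompletelyPositiveMap.norm_iterate_le (hπ : Function.Injective π) {T : A →CP A}
    (hT : T 1 = 1) (k : ℕ) (a : A) : ‖T^[k] a‖ ≤ ‖a‖ := by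
  induction k with
  | zero => rfl
  | succ k ih =>
    rw [Function.iterate_succ_apply']
    exact (T.norm_apply_le hπ hT _).trans ih

theorem CompletelyPositiveMap.norm_iterate_sub_le (hπ : Function.Injective π) {T : A →CP A}
    (hT : T 1 = 1) (k : ℕ) (a b : A) : ‖T^[k] a - T^[k] b‖ ≤ ‖a - b‖ := by
  have : T^[k] a - T^[k] b = T^[k] (a - b) := by
    induction k with
    | zero => rfl
    | succ k ih => rw [Function.iterate_succ_apply', Function.iterate_succ_apply', ← map_sub, ih,
        Function.iterate_succ_apply']
  rw [this]
  exact T.norm_iterate_le hπ hT k _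

/-- The orbit seen through `f ∘ T` is the shifted orbit seen through `f`, and a shift does not
change the limit. -/
theorem IsUniqueWeakMixing.apply_proj (hπ : Function.Injective π) {T : A →CP A}
    (hT : T 1 = 1) {E : A →L[ℂ] A} (h : IsUniqueWeakMixing T E) (a : A) : T (E a) = E a := by
  let TL : A →L[ℂ] A := LinearMap.mkContinuous (T : A →ₗ[ℂ] A) 1 fun a => by
    rw [one_mul]
    exact T.norm_apply_le hπ hT a
  refine (SeparatingDual.eq_iff_forall_dual_eq (R := ℂ)).2 fun f => ?_
  have h1 := h.strongCesaro hπ (f ∘L TL) a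
  have h2 := (h.strongCesaro hπ f a).shift (C := ‖f‖ * ‖a‖) fun k => by
    refine (f.le_opNorm _).trans ?_
    gcongr
    exact T.norm_iterate_le hπ hT k a
  have h3 : (fun k => (f ∘L TL) (T^[k] a)) = fun k => f (T^[k + 1] a) := by
    ext k
    rw [Function.iterate_succ_apply']
    rfl
  rw [h3] at h1
  exact h1.unique h2

theorem IsUniqueWeakMixing.proj_one (hπ : Function.Injective π) {T : A →CP A}
    (hT : T 1 = 1) {E : A →L[ℂ] A} (h : IsUniqueWeakMixing T E) : E 1 = 1 := by
  refine (SeparatingDual.eq_iff_forall_dual_eq (R := ℂ)).2 fun f => ?_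
  have h1 := h.strongCesaro hπ f 1
  simp only [Function.iterate_fixed hT] at h1
  exact h1.eq_of_const.symm

theorem IsNormOneProjection.nontrivial_of_injective {A : Type*} [CStarAlgebra A]
    {π : A →⋆ₐ[ℂ] (H →L[ℂ] H)} (hπ : Function.Injective π) {E : A →L[ℂ] A}
    (hE : IsNormOneProjection E) : Nontrivial H := by
  by_contra hH
  rw [not_nontrivial_iff_subsingleton] at hH
  have : Subsingleton A := hπ.subsingleton
  have h0 : E = 0 := Subsingleton.elim _ _
  have := hE.norm_eq_one
  simp [h0] at this

theorem IsUniqueWeakMixing.isUniqueErgodic {A : Type*} [CStarAlgebra A] {T : A → A}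
    (hT : ∀ k a, ‖T^[k] a‖ ≤ ‖a‖) {E : A →L[ℂ] A} (h : IsUniqueWeakMixing T E) :
    IsUniqueErgodic T E where
  proj := h.proj
  tendsto φ hφ x := StrongCesaro.tendsto_average (h.tendsto φ hφ x) (C := ‖φ‖ * ‖x‖) fun k => by
    refine (φ.le_opNorm _).trans ?_
    gcongr
    exact hT k x

theorem ContinuousLinearMap.opNorm_le_of_norm_inner_le {L : Type*} [NormedAddCommGroup L]
    [InnerProductSpace ℂ L] {S : L →L[ℂ] L} {c : ℝ} (hc : 0 ≤ c)
    (h : ∀ u v, ‖⟪u, S v⟫_ℂ‖ ≤ c * ‖u‖ * ‖v‖) : ‖S‖ ≤ c := by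
  refine ContinuousLinearMap.opNorm_le_bound _ hc fun v => ?_
  rcases eq_or_ne (S v) 0 with h0 | h0
  · rw [h0, norm_zero]
    positivity
  · have h1 := h (S v) v
    rw [inner_self_eq_ofReal_norm_sq, Complex.norm_real, Real.norm_of_nonneg (by positivity)] at h1
    have : 0 < ‖S v‖ := norm_pos_iff.2 h0
    nlinarith

end Contraction

theorem TensorProduct.map_map_apply_of_fixed {V W : Type*} [AddCommGroup V] [Module ℂ V]
    [AddCommGroup W] [Module ℂ W] {f e : V →ₗ[ℂ] V} {g p : W →ₗ[ℂ] W}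
    (hf : ∀ v, f (e v) = e v) (hg : ∀ w, g (p w) = p w) (z : V ⊗[ℂ] W) :
    TensorProduct.map f g (TensorProduct.map e p z) = TensorProduct.map e p z := by
  induction z with
  | zero => simp
  | add z w hz hw => simp [hz, hw]
  | tmul v w => simp [hf, hg]

/-! ### Mixing of the tensor product system -/

section TensorDynamics

variable {A B H K : Type*} [CStarAlgebra A] [PartialOrder A] [StarOrderedRing A]
  [CStarAlgebra B] [PartialOrder B] [StarOrderedRing B]
  [NormedAddCommGroup H] [InnerProductSpace ℂ H] [CompleteSpace H]
  [NormedAddCommGroup K] [InnerProductSpace ℂ K] [CompleteSpace K]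
  {π : A →⋆ₐ[ℂ] (H →L[ℂ] H)} {ρ : B →⋆ₐ[ℂ] (K →L[ℂ] K)}
  {T : A →CP A} {R : B →CP B} {ET : A →L[ℂ] A} {ER : B →L[ℂ] B}

namespace MinTensor

omit [PartialOrder A] [StarOrderedRing A] [PartialOrder B] [StarOrderedRing B] in
theorem iterate_tmul {T : A → A} {R : B → B} {Φ : MinTensor π ρ → MinTensor π ρ}
    (hΦ : IsTensorMap π ρ T R Φ) (k : ℕ) (a : A) (b : B) :
    Φ^[k] (tmul π ρ a b) = tmul π ρ (T^[k] a) (R^[k] b) := by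
  induction k generalizing a b with
  | zero => rfl
  | succ k ih => rw [Function.iterate_succ_apply, hΦ, ih]; rfl

omit [PartialOrder A] [StarOrderedRing A] [PartialOrder B] [StarOrderedRing B] in
theorem inner_val_eq_zero_of_incl {z : MinTensor π ρ}
    (h : ∀ x x' y y', ⟪HilbertTensor.incl H K (x ⊗ₜ y),
      val π ρ z (HilbertTensor.incl H K (x' ⊗ₜ y'))⟫_ℂ = 0) : z = 0 :=
  ext_val π ρ fun x y => ext_inner_incl fun x' y' => by simp [h]

omit [PartialOrder A] [StarOrderedRing A] [PartialOrder B] [StarOrderedRing B] in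
-- On a complex space the quadratic form determines the operator. This form is needed for
-- uniqueness, where only states may be tested.
theorem eq_zero_of_inner_incl_self {z : MinTensor π ρ}
    (h : ∀ u, ⟪HilbertTensor.incl H K u, val π ρ z (HilbertTensor.incl H K u)⟫_ℂ = 0) : z = 0 := by
  apply val_injective π ρ
  rw [map_zero, ← ContinuousLinearMap.coe_inj, ContinuousLinearMap.toLinearMap_zero,
    ← inner_map_self_eq_zero]
  intro v
  have h0 : ⟪v, val π ρ z v⟫_ℂ = 0 := isClosed_property HilbertTensor.denseRange_incl
    (p := fun v => ⟪v, val π ρ z v⟫_ℂ = 0) (isClosed_eq (by fun_prop) continuous_const) h v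
  rw [← inner_conj_symm]
  exact (congrArg (starRingEnd ℂ) h0).trans (map_zero _)

omit [PartialOrder A] [StarOrderedRing A] [PartialOrder B] [StarOrderedRing B] in
theorem iterate_add (Φ : MinTensor π ρ →CP MinTensor π ρ) (k : ℕ) (z w : MinTensor π ρ) :
    Φ^[k] (z + w) = Φ^[k] z + Φ^[k] w := by
  induction k generalizing z w with
  | zero => rfl
  | succ k ih => rw [Function.iterate_succ_apply, map_add, ih]; rfl

theorem strongCesaro_ofAlg {Φ : MinTensor π ρ →CP MinTensor π ρ} (hΦ : IsTensorMap π ρ T R Φ)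
    (hπ : Function.Injective π) (hρ : Function.Injective ρ) (hR : R 1 = 1)
    (hET : IsUniqueWeakMixing T ET) (hER : IsUniqueWeakMixing R ER)
    {θ : MinTensor π ρ →L[ℂ] ℂ} {f : A →L[ℂ] ℂ} {g : B →L[ℂ] ℂ}
    (hθ : ∀ a b, θ (tmul π ρ a b) = f a * g b) (z : A ⊗[ℂ] B) :
    StrongCesaro (fun k => θ (Φ^[k] (ofAlg π ρ z))) (θ (ofAlg π ρ
      (TensorProduct.map (ET : A →ₗ[ℂ] A) (ER : B →ₗ[ℂ] B) z))) := by
  induction z with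
  | zero =>
    have h0 (k : ℕ) : Φ^[k] 0 = 0 := Function.iterate_fixed (map_zero Φ) k
    simpa [h0] using StrongCesaro.const 0
  | add z w hz hw => simpa [iterate_add] using hz.add hw
  | tmul a b =>
    simp only [ofAlg_tmul, iterate_tmul hΦ, TensorProduct.map_tmul, hθ]
    refine (hET.strongCesaro hπ f a).mul (hER.strongCesaro hρ g b) (C := ‖g‖ * ‖b‖) fun k => ?_
    refine (g.le_opNorm _).trans ?_
    gcongr
    exact R.norm_iterate_le hρ hR k b

theorem strongCesaro_inner_ofAlg {Φ : MinTensor π ρ →CP MinTensor π ρ}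
    (hΦ : IsTensorMap π ρ T R Φ)
    (hπ : Function.Injective π) (hρ : Function.Injective ρ) (hR : R 1 = 1)
    (hET : IsUniqueWeakMixing T ET) (hER : IsUniqueWeakMixing R ER) (z : A ⊗[ℂ] B)
    (u v : H ⊗[ℂ] K) :
    StrongCesaro (fun k => ⟪HilbertTensor.incl H K u, val π ρ (Φ^[k] (ofAlg π ρ z))
        (HilbertTensor.incl H K v)⟫_ℂ)
      ⟪HilbertTensor.incl H K u, val π ρ (ofAlg π ρ
        (TensorProduct.map (ET : A →ₗ[ℂ] A) (ER : B →ₗ[ℂ] B) z)) (HilbertTensor.incl H K v)⟫_ℂ := by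
  induction u with
  | zero => simpa using StrongCesaro.const 0
  | add u u' hu hu' => simpa [inner_add_left] using hu.add hu'
  | tmul x y =>
    induction v with
    | zero => simpa using StrongCesaro.const 0
    | add v v' hv hv' => simpa [inner_add_right] using hv.add hv'
    | tmul x' y' =>
      exact strongCesaro_ofAlg hΦ hπ hρ hR hET hER
        (θ := vectorFunctional (val π ρ) (HilbertTensor.incl H K (x ⊗ₜ y))
          (HilbertTensor.incl H K (x' ⊗ₜ y')))
        (f := vectorFunctional π x x') (g := vectorFunctional ρ y y')
        (fun a b => inner_val_tmul π ρ a b x x' y y') z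

/-- The coefficients of `Φ^[k] z` are at most `‖z‖ * ‖u‖ * ‖v‖`, and strong Cesàro limits inherit
the bound. -/
theorem norm_ofAlg_map_proj_le (hπ : Function.Injective π) (hρ : Function.Injective ρ)
    (hT : T 1 = 1) (hR : R 1 = 1)
    (hET : IsUniqueWeakMixing T ET) (hER : IsUniqueWeakMixing R ER) (z : A ⊗[ℂ] B) :
    ‖ofAlg π ρ (TensorProduct.map (ET : A →ₗ[ℂ] A) (ER : B →ₗ[ℂ] B) z)‖ ≤ ‖ofAlg π ρ z‖ := by
  have hΦ : IsTensorMap π ρ T R (mapCP hπ hρ hT hR) :=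
    isTensorMap_mapL (norm_ofAlg_map_le hπ hρ hT hR)
  rw [← norm_val]
  refine ContinuousLinearMap.opNorm_le_of_norm_inner_le (norm_nonneg _) fun u v => ?_
  refine isClosed_property2 HilbertTensor.denseRange_incl
    (p := fun u v => ‖⟪u, val π ρ _ v⟫_ℂ‖ ≤ ‖ofAlg π ρ z‖ * ‖u‖ * ‖v‖)
    (isClosed_le (by fun_prop) (by fun_prop)) (fun u v => ?_) u v
  refine (strongCesaro_inner_ofAlg hΦ hπ hρ hR hET hER z u v).norm_le fun k => ?_
  calc _ ≤ ‖HilbertTensor.incl H K u‖ * (‖ofAlg π ρ z‖ * ‖HilbertTensor.incl H K v‖) := by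
        refine (norm_inner_le_norm _ _).trans ?_
        gcongr
        refine ContinuousLinearMap.le_of_opNorm_le _ ?_ _
        rw [norm_val]
        exact CompletelyPositiveMap.norm_iterate_le (val_injective π ρ) (mapCP_one hπ hρ hT hR) k _
    _ = _ := by ring

end MinTensor

open MinTensor

/-- Two approximations: of the functional by combinations of `f ⊗ g`, then of the element by
algebraic tensors. Contractivity makes both uniform in the number of iterations. -/
theorem DualTensorCondition.isUniqueWeakMixing (hdual : DualTensorCondition π ρ)
    {Φ : MinTensor π ρ →CP MinTensor π ρ} (hΦ1 : Φ 1 = 1) (hΦ : IsTensorMap π ρ T R Φ)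
    {EE : MinTensor π ρ →L[ℂ] MinTensor π ρ} (hproj : IsNormOneProjection EE)
    (hEE : ∀ z, EE (ofAlg π ρ z) =
      ofAlg π ρ (TensorProduct.map (ET : A →ₗ[ℂ] A) (ER : B →ₗ[ℂ] B) z))
    (hπ : Function.Injective π) (hρ : Function.Injective ρ) (hR : R 1 = 1)
    (hET : IsUniqueWeakMixing T ET) (hER : IsUniqueWeakMixing R ER) :
    IsUniqueWeakMixing Φ EE where
  proj := hproj
  tendsto φ _ w := by
    have hEEle (w : MinTensor π ρ) : ‖EE w‖ ≤ ‖w‖ := by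
      simpa using EE.le_of_opNorm_le hproj.norm_eq_one.le w
    refine StrongCesaro.of_mem_closure
      (CompletelyPositiveMap.norm_iterate_le (val_injective π ρ) hΦ1 · w) (hEEle w) (fun θ hθ => ?_)
      (by
        have := (Submodule.eq_top_iff').1 hdual φ
        rwa [← SetLike.mem_coe, Submodule.topologicalClosure_coe] at this)
    rw [SetLike.mem_coe] at hθ
    induction hθ using Submodule.span_induction with
    | mem θ hθ =>
      obtain ⟨f, g, hfg⟩ := hθ
      refine StrongCesaro.of_denseRange
        (CompletelyPositiveMap.norm_iterate_sub_le (val_injective π ρ) hΦ1)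
        (fun w w' => by rw [← map_sub]; exact hEEle _) (denseRange_ofAlg π ρ) (fun z => ?_) w
      rw [hEE]
      exact strongCesaro_ofAlg hΦ hπ hρ hR hET hER hfg z
    | zero => exact StrongCesaro.const 0
    | add f g _ _ hf hg => exact hf.add hg
    | smul c f _ hf => exact hf.const_mul c

end TensorDynamics

end

/-! ### The tensor product system and its projection -/

theorem corollary3p2 {A B H K : Type*}
    [CStarAlgebra A] [PartialOrder A] [StarOrderedRing A]
    [CStarAlgebra B] [PartialOrder B] [StarOrderedRing B]
    [NormedAddCommGroup H] [InnerProductSpace ℂ H] [CompleteSpace H]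
    [NormedAddCommGroup K] [InnerProductSpace ℂ K] [CompleteSpace K]
    -- faithful representations, through which the minimal tensor product is realised
    (π : A →⋆ₐ[ℂ] (H →L[ℂ] H)) (hπ : Function.Injective π)
    (ρ : B →⋆ₐ[ℂ] (K →L[ℂ] K)) (hρ : Function.Injective ρ)
    -- the two C⋆-dynamical systems
    (T : A →CP A) (hT : T 1 = 1) (R : B →CP B) (hR : R 1 = 1)
    (ET : A →L[ℂ] A) (hET : IsUniqueWeakMixing T ET)
    (ER : B →L[ℂ] B) (hER : IsUniqueWeakMixing R ER) :
    -- the C⋆-dynamical system of `T ⊗ R` and the operator `E_T ⊗ E_R`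
    ∃ (TR : MinTensor π ρ →CP MinTensor π ρ) (EE : MinTensor π ρ →L[ℂ] MinTensor π ρ),
      TR 1 = 1 ∧ IsTensorMap π ρ T R TR ∧ IsTensorMap π ρ ET ER EE ∧
      -- `E_T ⊗ E_R` is a norm-one projection onto the fixed points of `T ⊗ R`
      IsNormOneProjection EE ∧ Set.range EE = {z | TR z = z} ∧
      -- it is the only candidate for the projection of `T ⊗ R`
      (∀ E : MinTensor π ρ →L[ℂ] MinTensor π ρ, IsUniqueErgodic TR E → E = EE) ∧
      (∀ E : MinTensor π ρ →L[ℂ] MinTensor π ρ, IsUniqueWeakMixing TR E → E = EE) ∧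
      -- if `(A ⊗ B)^* = A^* ⊗ B^*`, it is that projection
      (DualTensorCondition π ρ → IsUniqueWeakMixing TR EE) := by
  let TR := MinTensor.mapCP (π := π) (ρ := ρ) hπ hρ hT hR
  let EE := MinTensor.mapL π ρ (ET : A →ₗ[ℂ] A) (ER : B →ₗ[ℂ] B)
  have hTR1 : TR 1 = 1 := MinTensor.mapCP_one hπ hρ hT hR
  have hTR : IsTensorMap π ρ T R TR :=
    MinTensor.isTensorMap_mapL (MinTensor.norm_ofAlg_map_le hπ hρ hT hR)
  have hTRJ (z) : TR (MinTensor.ofAlg π ρ z) = MinTensor.ofAlg π ρ (TensorProduct.map _ _ z) :=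
    MinTensor.mapL_ofAlg (MinTensor.norm_ofAlg_map_le hπ hρ hT hR) z
  have hnorm := MinTensor.norm_ofAlg_map_proj_le hπ hρ hT hR hET hER
  have hEE : IsTensorMap π ρ ET ER EE := MinTensor.isTensorMap_mapL hnorm
  have hEEJ (z) : EE (MinTensor.ofAlg π ρ z) = MinTensor.ofAlg π ρ (TensorProduct.map _ _ z) :=
    MinTensor.mapL_ofAlg hnorm z
  have hEEle (w) : ‖EE w‖ ≤ ‖w‖ := MinTensor.norm_mapL_apply_le hnorm w
  have hTRcont : Continuous TR := (MinTensor.mapL π ρ (T : A →ₗ[ℂ] A) (R : B →ₗ[ℂ] B)).continuous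
  have hTRk (k : ℕ) (w : MinTensor π ρ) : ‖TR^[k] w‖ ≤ ‖w‖ :=
    CompletelyPositiveMap.norm_iterate_le (MinTensor.val_injective π ρ) hTR1 k w
  have hdense := MinTensor.denseRange_ofAlg π ρ
  have hidem (w) : EE (EE w) = EE w := by
    refine congrFun (hdense.equalizer (EE.continuous.comp EE.continuous) EE.continuous
      (funext fun z => ?_)) w
    simp only [Function.comp_apply, hEEJ]
    rw [TensorProduct.map_map_apply_of_fixed hET.proj.idem hER.proj.idem]
  have hfix (w) : TR (EE w) = EE w := by
    refine congrFun (hdense.equalizer (hTRcont.comp EE.continuous) EE.continuous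
      (funext fun z => ?_)) w
    simp only [Function.comp_apply, hEEJ, hTRJ]
    rw [TensorProduct.map_map_apply_of_fixed (f := (T : A →ₗ[ℂ] A)) (g := (R : B →ₗ[ℂ] B))
      (hET.apply_proj hπ hT) (hER.apply_proj hρ hR)]
  have hSC (w : MinTensor π ρ) (u v : TensorProduct ℂ H K) :
      StrongCesaro (fun k => vectorFunctional (MinTensor.val π ρ) (HilbertTensor.incl H K u)
          (HilbertTensor.incl H K v) (TR^[k] w))
        (vectorFunctional (MinTensor.val π ρ) (HilbertTensor.incl H K u)
          (HilbertTensor.incl H K v) (EE w)) := by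
    refine StrongCesaro.of_denseRange
      (CompletelyPositiveMap.norm_iterate_sub_le (MinTensor.val_injective π ρ) hTR1)
      (fun w w' => by rw [← map_sub]; exact hEEle _) hdense (fun z => ?_) w
    rw [hEEJ]
    exact MinTensor.strongCesaro_inner_ofAlg hTR hπ hρ hR hET hER z u v
  have hproj : IsNormOneProjection EE := by
    refine ⟨le_antisymm ?_ ?_, hidem⟩
    · exact EE.opNorm_le_bound zero_le_one fun w => by simpa using hEEle w
    -- For the lower bound, `EE` fixes `1`, which has norm one once the tensor product is nonzero.
    -- Norm-one projections on the factors exclude trivial spaces.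
    · have : Nontrivial H := hET.proj.nontrivial_of_injective hπ
      have : Nontrivial K := hER.proj.nontrivial_of_injective hρ
      obtain ⟨x, hx⟩ := exists_ne (0 : H)
      obtain ⟨y, hy⟩ := exists_ne (0 : K)
      have : Nontrivial (MinTensor π ρ) := by
        refine ⟨1, 0, fun h => ?_⟩
        have h1 := MinTensor.inner_val_tmul π ρ 1 1 x x y y
        rw [MinTensor.tmul_one_one, h] at h1
        simp [hx, hy] at h1
      have hEE1 : EE 1 = 1 := by
        rw [← MinTensor.tmul_one_one, hEE, hET.proj_one hπ hT, hER.proj_one hρ hR]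
      have h1 := EE.le_opNorm 1
      rwa [hEE1, CStarRing.norm_one, mul_one] at h1
  have herg (E : MinTensor π ρ →L[ℂ] MinTensor π ρ) (hE : IsUniqueErgodic TR E) : E = EE := by
    ext w
    rw [← sub_eq_zero]
    refine MinTensor.eq_zero_of_inner_incl_self fun u => ?_
    rcases eq_or_ne u 0 with rfl | hu
    · simp
    -- Normalising `u` makes its vector functional a state, to which ergodicity of `E` applies; the
    -- mixing limit through `EE` must then agree.
    set c : ℂ := ((‖u‖⁻¹ : ℝ) : ℂ)
    have hu' : 0 < ‖u‖ := norm_pos_iff.2 hu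
    have hc : c ≠ 0 := Complex.ofReal_ne_zero.2 (inv_ne_zero hu'.ne')
    have hunit : ‖HilbertTensor.incl H K (c • u)‖ = 1 := by
      rw [LinearIsometry.norm_map, norm_smul, Complex.norm_real,
        Real.norm_of_nonneg (by positivity), inv_mul_cancel₀ hu'.ne']
    set φ := vectorFunctional (MinTensor.val π ρ) (HilbertTensor.incl H K (c • u))
      (HilbertTensor.incl H K (c • u))
    have h1 := hE.tendsto φ (isState_vectorFunctional _ hunit) w
    have h2 := (hSC w (c • u) (c • u)).tendsto_average (C := ‖φ‖ * ‖w‖) fun k => by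
      refine (φ.le_opNorm _).trans ?_
      gcongr
      exact hTRk k w
    have h3 : φ (E w - EE w) = 0 := by
      rw [map_sub, tendsto_nhds_unique h1 h2, sub_self]
    simpa [φ, inner_smul_left, inner_smul_right, hc, -map_sub] using h3
  refine ⟨TR, EE, hTR1, hTR, hEE, hproj, ?_, herg, fun E hE => herg E (hE.isUniqueErgodic hTRk),
    fun hdual => hdual.isUniqueWeakMixing hTR1 hTR hproj hEEJ hπ hρ hR hET hER⟩
  ext w
  constructor
  · rintro ⟨z, rfl⟩
    exact hfix z
  · intro hw
    -- A fixed point has constant coefficients along its orbit, so they equal those of the limit `EE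
    -- w`.
    refine ⟨w, (sub_eq_zero.1 (MinTensor.inner_val_eq_zero_of_incl fun x x' y y' => ?_)).symm⟩
    have h1 := hSC w (TensorProduct.tmul ℂ x y) (TensorProduct.tmul ℂ x' y')
    simp only [Function.iterate_fixed (show TR w = w from hw)] at h1
    have h2 := h1.eq_of_const
    simp only [vectorFunctional_apply] at h2
    simp [h2]
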